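/- Let $X$ be a separable metric space and $\mu$ a locally finite Borel measure on $X$ (for instance a Radon measure on a Polish metric space). *Fragments.* A fragment in $X$ is a biLipschitz map $\gamma:\operatorname{dom}\gamma\to X$ with $\operatorname{dom}\gamma\subset\mathbb R$ compact of positive Lebesgue measure. The set $\operatorname{Frag}(X)$ of fragments is identified, via graphs, with a subspace of the space of compact subsets of $\mathbb R\times X$ with the Vietoris (Hausdorff distance) topology. *Alberti representations.* An Alberti representation of $\mu$ is a pair $\mathcal A=(P,\nu)$ such that (1) $P$ is a Borel probability measure on $\operatorname{Frag}(X)$; (2) $\nu$ is a Borel map from $\operatorname{Frag}(X)$ to the finite (nonnegative) Borel measures on $X$, and $\nu_\gamma\ll\mathcal H^1_\gamma$, the one-dimensional Hausdorff measure restricted to the image of $\gamma$; (3) $\mu(E)=\int\nu_\gamma(E)\,dP(\gamma)$ for every Borel $E\subset X$; (4) for all Borel $E\subset X$ and real $a\le b$ the map $\gamma\mapsto\nu_\gamma\bigl(E\cap\gamma(\operatorname{dom}\gamma\cap[a,b])\bigr)$ is Borel. It is $C$-Lipschitz if $P$-a.e. $\gamma$ is $C$-Lipschitz. Let $\operatorname{Alb}(\mu)$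 be the set of Alberti representations of $\mu$ which are $C$-Lipschitz for some $C$, and $\operatorname{Alb}_{\rm sub}(\mu)=\bigcup\{\operatorname{Alb}(\mu\llcorner S): S\subset X\text{ Borel}\}$. *Derivations.* Let $\operatorname{Lip}_b(X)$ be the algebra of bounded real Lipschitz functions on $X$ with norm $\max(\|f\|_\infty,\operatorname{Lip}(f))$ and with the weak* topology given by its predual, the norm-closed linear span of the point evaluations in $\operatorname{Lip}_b(X)^*$; let $L^\infty(\mu)$ carry the weak* topology as the dual of $L^1(\mu)$. A (Weaver) derivation is a bounded linear map $D:\operatorname{Lip}_b(X)\to L^\infty(\mu)$ which is weak* continuous and satisfies $D(fg)=f\,Dg+g\,Df$. Let $\mathfrak X(\mu)$ be the space of derivations, with the operator norm. **Theorem.** (a) Let $\mathcal A=(P,\nu)$ be a $C$-Lipschitz Alberti representation of $\mu$. Then there is a derivation $D_{\mathcal A}\in\mathfrak X(\mu)$ with $\|D_{\mathcal A}\|\le C$ such that, for each $f\in\operatorname{Lip}_b(X)$, $D_{\mathcal A}f$ is the unique element of $L^\infty(\mu)$ satisfying $$\int_X g\,D_{\mathcal A}f\,d\mu=\int_{\operatorname{Frag}(X)}dP(\gamma)\int_{\operatorname{dom}\gamma}(f\circ\gamma)'(t)\,g(\gamma(t))\,d(\gamma^{-1}_\#\nu_\gamma)(t)=\int_{\operatorname{Frag}(X)}dP(\gamma)\int_X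 g\,\partial_\gamma f\,d\nu_\gamma$$ for all bounded Borel $g\in L^1(\mu)$, all the integrals being well defined (the inner ones for $P$-a.e. $\gamma$). Here $(f\circ\gamma)'(t)$ is the derivative relative to $\operatorname{dom}\gamma$, read as $0$ where it does not exist (in particular at isolated points of $\operatorname{dom}\gamma$), and $\partial_\gamma f(x)=(f\circ\gamma)'(\gamma^{-1}(x))$ if $x\in\operatorname{im}\gamma$ and the derivative exists, $\partial_\gamma f(x)=0$ otherwise. (b) There is a unique map $\operatorname{Der}:\operatorname{Alb}_{\rm sub}(\mu)\to\mathfrak X(\mu)$ such that, whenever $S\subset X$ is Borel and $\mathcal A\in\operatorname{Alb}(\mu\llcorner S)$, $\operatorname{Der}(\mathcal A)$ is the extension by zero of the derivation $D_{\mathcal A}\in\mathfrak X(\mu\llcorner S)$ given by (a): for each $f\in\operatorname{Lip}_b(X)$, $\operatorname{Der}(\mathcal A)f=D_{\mathcal A}f$ $\mu$-a.e. on $S$ and $\operatorname{Der}(\mathcal A)f=0$ $\mu$-a.e. on $X\setminus S$. -/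

import Mathlib

open MeasureTheory TopologicalSpace Set
open scoped NNReal ENNReal BoundedContinuousFunction

/-! ### Path fragments -/

/-- A path fragment in `X`: a biLipschitz map `γ : K → X` whose domain `K ⊆ ℝ` is compact and has
positive Lebesgue measure. -/
structure Frag (X : Type*) [MetricSpace X] where
  dom : Set ℝ
  toFun : dom → X
  isCompact_dom : IsCompact dom
  volume_pos : 0 < volume dom
  lipschitz : ∃ L : ℝ≥0, LipschitzWith L toFun
  antilipschitz : ∃ L : ℝ≥0, AntilipschitzWith L toFun

namespace Frag

section
variable {X : Type*} [MetricSpace X]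

instance : CoeFun (Frag X) (fun γ => γ.dom → X) := ⟨Frag.toFun⟩

/-- The image of a fragment. -/
def im (γ : Frag X) : Set X := range γ

/-- The graph of a fragment, a compact subset of `ℝ × X`. -/
def graph (γ : Frag X) : Compacts (ℝ × X) where
  carrier := range fun t : γ.dom => ((t : ℝ), γ t)
  isCompact' := by
    have := isCompact_iff_compactSpace.mp γ.isCompact_dom
    obtain ⟨L, hL⟩ := γ.lipschitz
    exact isCompact_range (continuous_subtype_val.prodMk hL.continuous)

/-- Fragments are topologized as a subspace of the compact subsets of `ℝ × X` with the Vietoris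
(Hausdorff distance) topology, through their graphs. -/
instance : TopologicalSpace (Frag X) := TopologicalSpace.induced graph inferInstance

instance : MeasurableSpace (Frag X) := borel (Frag X)

instance : BorelSpace (Frag X) := ⟨rfl⟩

/-- The derivative at `t ∈ dom γ`, relative to `dom γ`, of a function `h` defined on `dom γ`; it is
`0` where the derivative does not exist, and at isolated points of `dom γ`. -/
noncomputable def derivOn (γ : Frag X) (h : γ.dom → ℝ) (t : γ.dom) : ℝ :=
  derivWithin (Function.extend Subtype.val h 0) γ.dom t

open Classical in
/-- `∂_γ f (x) = (f ∘ γ)'(γ⁻¹(x))` if `x` is in the image of `γ` and the derivative exists,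
and `0` otherwise. -/
noncomputable def partialDeriv (γ : Frag X) (f : X → ℝ) (x : X) : ℝ :=
  if h : ∃ t : γ.dom, γ t = x then γ.derivOn (fun t => f (γ t)) h.choose else 0

/-- The measure `(γ⁻¹)_# ν` on `dom γ`: the measure of `B ⊆ dom γ` is `ν (γ(B))`. -/
noncomputable def pullMeasure [MeasurableSpace X] (γ : Frag X) (ν : Measure X) :
    Measure γ.dom := ν.comap γ

theorem measurableEmbedding [MeasurableSpace X] [BorelSpace X] (γ : Frag X) :
    MeasurableEmbedding γ.toFun := by
  have := isCompact_iff_compactSpace.mp γ.isCompact_dom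
  obtain ⟨L, hL⟩ := γ.lipschitz
  obtain ⟨L', hL'⟩ := γ.antilipschitz
  exact (hL.continuous.isClosedEmbedding hL'.injective).measurableEmbedding

theorem pullMeasure_apply [MeasurableSpace X] [BorelSpace X] (γ : Frag X) (ν : Measure X)
    (B : Set γ.dom) : γ.pullMeasure ν B = ν (γ '' B) :=
  γ.measurableEmbedding.comap_apply ν B

end

end Frag

/-! ### Alberti representations -/

/-- A measure `P` on the fragments of `X`, together with a family `ν` of measures on `X` indexed by
the fragments. -/
structure FragPair (X : Type*) [MetricSpace X] [MeasurableSpace X] where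
  P : Measure (Frag X)
  ν : Frag X → Measure X

section Alberti
variable {X : Type*} [MetricSpace X] [MeasurableSpace X] [BorelSpace X]

/-- `A = (P, ν)` is an Alberti representation of `μ`. Measurability of `ν` refers to the σ-algebra
on measures generated by the evaluations at Borel sets. -/
structure IsAlbertiRep (A : FragPair X) (μ : Measure X) : Prop where
  isProbabilityMeasure : IsProbabilityMeasure A.P
  isFiniteMeasure : ∀ γ, IsFiniteMeasure (A.ν γ)
  measurable : Measurable A.ν
  absolutelyContinuous : ∀ γ : Frag X, A.ν γ ≪ (Measure.hausdorffMeasure 1).restrict γ.im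
  repr : ∀ E : Set X, MeasurableSet E → μ E = ∫⁻ γ, A.ν γ E ∂A.P
  measurable_subarc : ∀ E : Set X, MeasurableSet E → ∀ a b : ℝ, a ≤ b →
    Measurable fun γ : Frag X => A.ν γ (E ∩ γ '' {t | (t : ℝ) ∈ Icc a b})

/-- `A = (P, ν)` is `C`-Lipschitz if `P`-almost every fragment is `C`-Lipschitz. -/
def FragPair.IsCLipschitz (A : FragPair X) (C : ℝ≥0) : Prop :=
  ∀ᵐ γ ∂A.P, LipschitzWith C (Frag.toFun γ)

/-- The Alberti representations of `μ` which are Lipschitz. -/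
def Alb (μ : Measure X) : Set (FragPair X) :=
  {A | IsAlbertiRep A μ ∧ ∃ C : ℝ≥0, A.IsCLipschitz C}

/-- The Lipschitz Alberti representations of the restrictions of `μ` to Borel sets. -/
def AlbSub (μ : Measure X) : Set (FragPair X) :=
  {A | ∃ S : Set X, MeasurableSet S ∧ A ∈ Alb (μ.restrict S)}

end Alberti

/-! ### The algebra of bounded Lipschitz functions -/

/-- Bounded Lipschitz functions, as a subalgebra of the bounded continuous functions. -/
def lipSubalgebra (X : Type*) [MetricSpace X] : Subalgebra ℝ (X →ᵇ ℝ) where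
  carrier := {f | ∃ K : ℝ≥0, LipschitzWith K f}
  mul_mem' := by
    rintro f g ⟨K, hK⟩ ⟨L, hL⟩
    refine ⟨‖f‖₊ * L + ‖g‖₊ * K, LipschitzWith.of_dist_le_mul fun x y => ?_⟩
    have h1 := hK.dist_le_mul x y
    have h2 := hL.dist_le_mul x y
    have h3 := f.norm_coe_le_norm x
    have h4 := g.norm_coe_le_norm y
    simp only [Real.dist_eq, Real.norm_eq_abs] at h1 h2 h3 h4
    simp only [BoundedContinuousFunction.coe_mul, Pi.mul_apply, Real.dist_eq, NNReal.coe_add,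
      NNReal.coe_mul, coe_nnnorm]
    calc |f x * g x - f y * g y| = |f x * (g x - g y) + (f x - f y) * g y| := by ring_nf
      _ ≤ |f x| * |g x - g y| + |f x - f y| * |g y| := by
        rw [← abs_mul, ← abs_mul]; exact abs_add_le _ _
      _ ≤ ‖f‖ * (L * dist x y) + (K * dist x y) * ‖g‖ := by gcongr
      _ = (‖f‖ * L + ‖g‖ * K) * dist x y := by ring
  add_mem' := by
    rintro f g ⟨K, hK⟩ ⟨L, hL⟩
    exact ⟨K + L, hK.add hL⟩
  algebraMap_mem' := fun r => ⟨0, LipschitzWith.const r⟩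

/-- The algebra of bounded real-valued Lipschitz functions on `X`. -/
def LipB (X : Type*) [MetricSpace X] : Type _ := lipSubalgebra X

namespace LipB

section
variable {X : Type*} [MetricSpace X]

noncomputable instance : CommRing (LipB X) := inferInstanceAs (CommRing (lipSubalgebra X))

noncomputable instance : Algebra ℝ (LipB X) := inferInstanceAs (Algebra ℝ (lipSubalgebra X))

/-- The underlying bounded continuous function. -/
def toBCF (f : LipB X) : X →ᵇ ℝ := Subtype.val f

instance : CoeFun (LipB X) (fun _ => X → ℝ) := ⟨fun f => f.toBCF⟩

theorem mul_apply (f g : LipB X) (x : X) : (f * g) x = f x * g x := rfl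

theorem add_apply (f g : LipB X) (x : X) : (f + g) x = f x + g x := rfl

theorem smul_apply (c : ℝ) (f : LipB X) (x : X) : (c • f) x = c * f x := rfl

/-- The Lipschitz constants of `f`. -/
def lipSet (f : LipB X) : Set ℝ := {K | 0 ≤ K ∧ ∀ x y, |f x - f y| ≤ K * dist x y}

/-- The global Lipschitz constant of `f`. -/
noncomputable def glip (f : LipB X) : ℝ := sInf f.lipSet

theorem lipSet_nonempty (f : LipB X) : f.lipSet.Nonempty := by
  obtain ⟨K, hK⟩ := f.2
  exact ⟨K, K.2, fun x y => hK.dist_le_mul x y⟩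

theorem glip_nonneg (f : LipB X) : 0 ≤ f.glip := Real.sInf_nonneg fun _ h => h.1

theorem glip_le {f : LipB X} {K : ℝ} (hK : K ∈ f.lipSet) : f.glip ≤ K :=
  csInf_le ⟨0, fun _ h => h.1⟩ hK

theorem glip_mem (f : LipB X) : f.glip ∈ f.lipSet := by
  refine ⟨f.glip_nonneg, fun x y => ?_⟩
  rcases eq_or_lt_of_le (dist_nonneg (x := x) (y := y)) with h | h
  · obtain ⟨K, -, hK⟩ := f.lipSet_nonempty
    simpa [← h] using hK x y
  · rw [← div_le_iff₀ h]
    exact le_csInf f.lipSet_nonempty fun K hK => (div_le_iff₀ h).2 (hK.2 x y)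

/-- The norm `max (sup |f|, Lip f)`. -/
noncomputable instance : Norm (LipB X) := ⟨fun f => max ‖f.toBCF‖ f.glip⟩

theorem norm_def (f : LipB X) : ‖f‖ = max ‖f.toBCF‖ f.glip := rfl

theorem normCore : NormedSpace.Core ℝ (LipB X) where
  norm_nonneg f := le_max_of_le_left (norm_nonneg _)
  norm_smul c f := by
    have key : ∀ (c : ℝ) (f : LipB X), (c • f).glip ≤ |c| * f.glip := fun c f => by
      refine glip_le ⟨mul_nonneg (abs_nonneg _) f.glip_nonneg, fun x y => ?_⟩
      rw [smul_apply, smul_apply, ← mul_sub, abs_mul, mul_assoc]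
      exact mul_le_mul_of_nonneg_left (f.glip_mem.2 x y) (abs_nonneg _)
    have hg : (c • f).glip = |c| * f.glip := by
      refine le_antisymm (key c f) ?_
      rcases eq_or_ne c 0 with rfl | hc
      · simpa using glip_nonneg _
      · have h := key c⁻¹ (c • f)
        rw [smul_smul, inv_mul_cancel₀ hc, one_smul, abs_inv] at h
        rwa [← le_inv_mul_iff₀ (abs_pos.2 hc)]
    have hb : ‖(c • f).toBCF‖ = |c| * ‖f.toBCF‖ := norm_smul c f.toBCF
    rw [norm_def, norm_def, hg, hb, Real.norm_eq_abs, mul_max_of_nonneg _ _ (abs_nonneg c)]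
  norm_triangle f g := by
    have hg : (f + g).glip ≤ f.glip + g.glip := by
      refine glip_le ⟨add_nonneg f.glip_nonneg g.glip_nonneg, fun x y => ?_⟩
      rw [add_apply, add_apply, add_mul, add_sub_add_comm]
      exact (abs_add_le _ _).trans (add_le_add (f.glip_mem.2 x y) (g.glip_mem.2 x y))
    have hb : ‖(f + g).toBCF‖ ≤ ‖f.toBCF‖ + ‖g.toBCF‖ := norm_add_le f.toBCF g.toBCF
    exact max_le (hb.trans (add_le_add (le_max_left _ _) (le_max_left _ _)))
      (hg.trans (add_le_add (le_max_right _ _) (le_max_right _ _)))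
  norm_eq_zero_iff f := by
    refine ⟨fun h => ?_, ?_⟩
    · have h0 : ‖f.toBCF‖ ≤ 0 := (le_max_left _ _).trans h.le
      exact Subtype.ext (norm_le_zero_iff.1 h0)
    · rintro rfl
      have h1 : (0 : LipB X).glip ≤ 0 := glip_le ⟨le_rfl, fun x y => by
        change |(0 : ℝ) - 0| ≤ _
        simp⟩
      have h2 : ‖(0 : LipB X).toBCF‖ = 0 := norm_zero (E := X →ᵇ ℝ)
      rw [norm_def, h2]
      exact max_eq_left h1

noncomputable instance : NormedAddCommGroup (LipB X) := NormedAddCommGroup.ofCore normCore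

noncomputable instance : NormedSpace ℝ (LipB X) := NormedSpace.ofCore normCore

/-- Evaluation at a point. -/
noncomputable def pointEval (x : X) : StrongDual ℝ (LipB X) :=
  LinearMap.mkContinuous
    { toFun := fun f => f x
      map_add' := fun _ _ => rfl
      map_smul' := fun _ _ => rfl } 1 fun f => by
    rw [one_mul]
    exact (f.toBCF.norm_coe_le_norm x).trans (le_max_left _ _)

variable (X) in
/-- The predual of the Banach space of bounded Lipschitz functions: the norm-closed linear span of
the point evaluations in its dual. -/
noncomputable def predual : Submodule ℝ (StrongDual ℝ (LipB X)) :=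
  (Submodule.span ℝ (range (pointEval (X := X)))).topologicalClosure

variable (X) in
/-- The weak* topology on bounded Lipschitz functions: the coarsest topology for which all elements
of the predual are continuous. -/
@[reducible]
noncomputable def weakStar : TopologicalSpace (LipB X) :=
  ⨅ φ ∈ predual X, TopologicalSpace.induced (fun f : LipB X => φ f) inferInstance

end

end LipB

/-! ### Derivations -/

section Derivations
variable {X : Type*} [MetricSpace X] [MeasurableSpace X]

/-- The weak* topology of `L^∞(μ)` as the dual of `L¹(μ)`. -/
@[reducible]
noncomputable def linftyWeakStar (μ : Measure X) : TopologicalSpace (Lp ℝ ∞ μ) :=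
  ⨅ h ∈ {h : X → ℝ | Integrable h μ},
    TopologicalSpace.induced (fun u : Lp ℝ ∞ μ => ∫ x, h x * u x ∂μ) inferInstance

/-- Continuity from the weak* topology of the bounded Lipschitz functions to the weak* topology of
`L^∞(μ)`. -/
def IsWeakStarContinuous (μ : Measure X) (D : LipB X →L[ℝ] Lp ℝ ∞ μ) : Prop :=
  @Continuous (LipB X) (Lp ℝ ∞ μ) (LipB.weakStar X) (linftyWeakStar μ) D

theorem isWeakStarContinuous_iff {μ : Measure X} {D : LipB X →L[ℝ] Lp ℝ ∞ μ} :
    IsWeakStarContinuous μ D ↔ ∀ h : X → ℝ, Integrable h μ →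
      @Continuous (LipB X) ℝ (LipB.weakStar X) inferInstance
        (fun f => ∫ x, h x * D f x ∂μ) := by
  let _ := LipB.weakStar X
  unfold IsWeakStarContinuous linftyWeakStar
  simp only [continuous_iInf_rng, continuous_induced_rng, mem_ofPred_eq]
  rfl

/-- The product rule `D(fg) = f Dg + g Df` in `L^∞(μ)`. -/
def SatisfiesProductRule (μ : Measure X) (D : LipB X →L[ℝ] Lp ℝ ∞ μ) : Prop :=
  ∀ f g : LipB X, D (f * g) =ᵐ[μ] fun x => f x * D g x + g x * D f x

theorem integrable_mul_linfty {X : Type*} [MeasurableSpace X] {μ : Measure X} {h : X → ℝ} (hh : Integrable h μ)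
    (u : Lp ℝ ∞ μ) : Integrable (fun x => h x * u x) μ := by
  have := hh.smul_of_top_right (Lp.memLp u)
  refine this.congr (Filter.Eventually.of_forall fun x => ?_)
  simp [mul_comm]

/-- The space of derivations: the bounded linear maps from the bounded Lipschitz functions to
`L^∞(μ)` that are weak* continuous and satisfy the product rule. It carries the operator norm. -/
noncomputable def Derivations (μ : Measure X) : Submodule ℝ (LipB X →L[ℝ] Lp ℝ ∞ μ) where
  carrier := {D | IsWeakStarContinuous μ D ∧ SatisfiesProductRule μ D}
  add_mem' := by
    rintro D E ⟨hD, hD'⟩ ⟨hE, hE'⟩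
    refine ⟨?_, fun f g => ?_⟩
    · rw [isWeakStarContinuous_iff] at *
      intro h hh
      let _ := LipB.weakStar X
      refine ((hD h hh).add (hE h hh)).congr fun f => ?_
      rw [Pi.add_apply,
        ← integral_add (integrable_mul_linfty hh _) (integrable_mul_linfty hh _)]
      refine integral_congr_ae ?_
      filter_upwards [Lp.coeFn_add (D f) (E f)] with x hx
      rw [add_apply, hx, Pi.add_apply, mul_add]
    · filter_upwards [hD' f g, hE' f g, Lp.coeFn_add (D (f * g)) (E (f * g)),
        Lp.coeFn_add (D f) (E f), Lp.coeFn_add (D g) (E g)] with x h1 h2 h3 h4 h5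
      simp only [add_apply, h3, h4, h5, Pi.add_apply, h1, h2]
      ring
  zero_mem' := by
    refine ⟨?_, fun f g => ?_⟩
    · rw [isWeakStarContinuous_iff]
      intro h hh
      let _ := LipB.weakStar X
      refine (continuous_const (y := (0 : ℝ))).congr fun f => ?_
      symm
      refine integral_eq_zero_of_ae ?_
      filter_upwards [Lp.coeFn_zero ℝ ∞ μ] with x hx
      change h x * (0 : Lp ℝ ∞ μ) x = 0
      rw [hx, Pi.zero_apply, mul_zero]
    · filter_upwards [Lp.coeFn_zero ℝ ∞ μ] with x hx
      change (0 : Lp ℝ ∞ μ) x = f x * (0 : Lp ℝ ∞ μ) x + g x * (0 : Lp ℝ ∞ μ) x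
      rw [hx, Pi.zero_apply, mul_zero, mul_zero, add_zero]
  smul_mem' := by
    rintro c D ⟨hD, hD'⟩
    refine ⟨?_, fun f g => ?_⟩
    · rw [isWeakStarContinuous_iff] at *
      intro h hh
      let _ := LipB.weakStar X
      refine ((hD h hh).const_mul c).congr fun f => ?_
      rw [← integral_const_mul]
      refine integral_congr_ae ?_
      filter_upwards [Lp.coeFn_smul c (D f)] with x hx
      rw [smul_apply, hx, Pi.smul_apply, smul_eq_mul]
      ring
    · filter_upwards [hD' f g, Lp.coeFn_smul c (D (f * g)), Lp.coeFn_smul c (D f),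
        Lp.coeFn_smul c (D g)] with x h1 h3 h4 h5
      simp only [smul_apply, h3, h4, h5, Pi.smul_apply, h1, smul_eq_mul]
      ring

/-- `D'` is the extension by zero to `X` of the derivation `D` with respect to the restriction of
`μ` to `S`; the extensions by zero of such derivations are the elements of `χ_S · Derivations μ`. -/
def IsZeroExtension {μ : Measure X} (S : Set X) (D : Derivations (μ.restrict S))
    (D' : Derivations μ) : Prop :=
  ∀ f : LipB X, (D'.1 f =ᵐ[μ.restrict S] D.1 f) ∧ (D'.1 f =ᵐ[μ.restrict Sᶜ] 0)

/-- The identity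
`∫ g u dμ = ∫ dP(γ) ∫_{dom γ} (f ∘ γ)'(t) g(γ(t)) d(γ⁻¹_# ν_γ)(t) = ∫ dP(γ) ∫_X g ∂_γ f dν_γ`
for all bounded Borel `μ`-integrable `g`, including the existence of all the integrals. -/
structure AlbertiFormula (A : FragPair X) (μ : Measure X) (f : X → ℝ) (u : Lp ℝ ∞ μ)
    (g : X → ℝ) : Prop where
  integrable_left : Integrable (fun x => g x * u x) μ
  integrable_dom : ∀ᵐ γ ∂A.P,
    Integrable (fun t : γ.dom => γ.derivOn (fun s => f (γ s)) t * g (γ t)) (γ.pullMeasure (A.ν γ))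
  integrable_mid : Integrable (fun γ : Frag X =>
    ∫ t : γ.dom, γ.derivOn (fun s => f (γ s)) t * g (γ t) ∂(γ.pullMeasure (A.ν γ))) A.P
  integrable_im : ∀ᵐ γ ∂A.P, Integrable (fun x => g x * γ.partialDeriv f x) (A.ν γ)
  integrable_right : Integrable (fun γ : Frag X =>
    ∫ x, g x * γ.partialDeriv f x ∂(A.ν γ)) A.P
  eq_mid : ∫ x, g x * u x ∂μ = ∫ γ : Frag X,
    (∫ t : γ.dom, γ.derivOn (fun s => f (γ s)) t * g (γ t) ∂(γ.pullMeasure (A.ν γ))) ∂A.P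
  eq_right : ∫ x, g x * u x ∂μ = ∫ γ : Frag X, (∫ x, g x * γ.partialDeriv f x ∂(A.ν γ)) ∂A.P

/-- `D` is the derivation defined by the formula: for every `f`, the element `D f` of `L^∞(μ)`, and
no other one, satisfies the formula for all bounded Borel `μ`-integrable `g`. -/
def IsAlbertiDerivation (A : FragPair X) (μ : Measure X) (D : Derivations μ) : Prop :=
  ∀ (f : LipB X) (u : Lp ℝ ∞ μ),
    (∀ g : X → ℝ, Measurable g → (∃ M : ℝ, ∀ x, |g x| ≤ M) → Integrable g μ →
      AlbertiFormula A μ f u g) ↔ u = D.1 f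

end Derivations

open Filter Topology

/-! ### A Borel version of the derivative along fragments -/

/-! Regard `ν` as a kernel and let `m = P ⊗ ν` on `Frag X × X`; condition (3) says that the second
marginal of `m` is `μ`. The right-hand side of the formula is then the integral of `g(x) ∂_γ f(x)`
against `m`, and `D f` is the conditional expectation of `∂_γ f(x)` given `x`. It is bounded by
`C‖f‖`, and linearity and the product rule hold because they hold along each fragment, almost
everywhere, and pass to the conditional expectation by testing against `g`.

Two points need work. The first is joint measurability: `(γ, x) ↦ ∂_γ f(x)` is replaced by the Borel
function `Frag.upperSlope`, an upper limit of difference quotients built from closed sets. By almost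
everywhere differentiability of Lipschitz functions on the line and `ν_γ ≪ H¹`, the two agree
`ν_γ`-a.e. for every `γ` (`Frag.upperSlope_ae_eq`).

The second is weak* continuity: for `g ∈ L¹(μ)` the functional `f ↦ ∫ g D f dμ` must lie in the
predual. Along one fragment it equals `∫ w (F f)' dt`, where `F f` is a Lipschitz extension of `f ∘
γ` and `w ∈ L¹(ℝ)` vanishes off `dom γ`. Approximating `w` in `L¹` by step functions whose intervals
have endpoints in `dom γ` turns this integral into a combination of differences `f(γ(b)) - f(γ(a))`,
with error at most a small multiple of `‖f‖`; so it is a norm limit of combinations of point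
evaluations (`Frag.exists_mem_predual`). As `X` is separable, so is the predual; a Pettis-type
argument makes the family of these functionals strongly measurable, and its Bochner integral over
`P` stays in the closed predual.

For (b), a representation determines the measure it represents, so it determines `S` up to a
`μ`-null set, and the extension by zero does not see null sets. -/

theorem isClosed_setOf_exists_mem_compacts {W Y : Type*} [TopologicalSpace W] [TopologicalSpace Y]
    {K : W → Compacts Y} (hK : Continuous K) {Z : Set (W × Y)} (hZ : IsClosed Z) :
    IsClosed {w | ∃ p ∈ K w, (w, p) ∈ Z} := by
  rw [← isOpen_compl_iff, isOpen_iff_mem_nhds]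
  intro w hw
  have hsub : ({w} : Set W) ×ˢ (K w : Set Y) ⊆ Zᶜ := by
    rintro ⟨w', p⟩ ⟨rfl, hp⟩ hz
    exact hw ⟨p, hp, hz⟩
  -- The compact slice over `w` misses `Z`, hence has a product neighbourhood missing `Z`; in the
  -- Vietoris topology nearby compacts remain inside its second factor.
  obtain ⟨U, V, hU, hV, hwU, hKV, hUV⟩ :=
    generalized_tube_lemma isCompact_singleton (K w).isCompact hZ.isOpen_compl hsub
  have h1 : ∀ᶠ w' in 𝓝 w, (K w' : Set Y) ⊆ V :=
    hK.continuousAt.eventually ((Compacts.isOpen_subsets_of_isOpen hV).mem_nhds hKV)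
  filter_upwards [h1, hU.mem_nhds (hwU rfl)] with w' h2 h3
  rintro ⟨p, hp, hz⟩
  exact hUV (mk_mem_prod h3 (h2 hp)) hz

namespace Frag

section
variable {X : Type*} [MetricSpace X]

theorem continuous_graph : Continuous (graph (X := X)) := continuous_induced_dom

theorem injective (γ : Frag X) : Function.Injective γ.toFun :=
  γ.antilipschitz.choose_spec.injective

/-- The pairs `(γ, x)` such that some difference quotient of `f ∘ γ` at `γ⁻¹(x)`, with increment of
size between `δ` and `η`, is at least `c`. -/
def slopeSet (f : X → ℝ) (c δ η : ℝ) : Set (Frag X × X) :=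
  {q | ∃ a ∈ q.1.graph, ∃ b ∈ q.1.graph, a.2 = q.2 ∧ δ ≤ |b.1 - a.1| ∧ |b.1 - a.1| ≤ η ∧
    c * (b.1 - a.1) ^ 2 ≤ (f b.2 - f a.2) * (b.1 - a.1)}

/-- Multiplying the slope inequality by the squared increment removes the division, and all
conditions become non-strict inequalities or equalities between continuous functions. The two
existential points range over the graph, a compact set depending continuously on the fragment. -/
theorem isClosed_slopeSet {f : X → ℝ} (hf : Continuous f) (c δ η : ℝ) :
    IsClosed (slopeSet f c δ η) := by
  refine isClosed_setOf_exists_mem_compacts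
    (Z := {z | ∃ b ∈ z.1.1.graph, (z, b) ∈ {y : ((Frag X × X) × (ℝ × X)) × (ℝ × X) |
      y.1.2.2 = y.1.1.2 ∧ δ ≤ |y.2.1 - y.1.2.1| ∧ |y.2.1 - y.1.2.1| ≤ η ∧
      c * (y.2.1 - y.1.2.1) ^ 2 ≤ (f y.2.2 - f y.1.2.2) * (y.2.1 - y.1.2.1)}})
    (continuous_graph.comp continuous_fst) ?_
  refine isClosed_setOf_exists_mem_compacts
    (continuous_graph.comp (continuous_fst.comp continuous_fst)) ?_
  simp only [ofPred_and]
  refine (isClosed_eq ?_ ?_).inter ((isClosed_le ?_ ?_).inter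
    ((isClosed_le ?_ ?_).inter (isClosed_le ?_ ?_))) <;> fun_prop

/-- The pairs `(γ, x)` such that `f ∘ γ` has difference quotients at `γ⁻¹(x)` which are at least
`c`, with arbitrarily small increments. -/
def limsupSlopeSet (f : X → ℝ) (c : ℝ) : Set (Frag X × X) :=
  ⋂ n : ℕ, ⋃ m : ℕ, slopeSet f c (1 / (m + 1)) (1 / (n + 1))

open Classical in
/-- The upper limit of the difference quotients of `f ∘ γ` at `γ⁻¹(x)`, as a function of
`(γ, x)`. -/
noncomputable def upperSlope (f : X → ℝ) (q : Frag X × X) : ℝ :=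
  -- `toReal` sends both infinite values to `0`; only points where the supremum is finite matter
  -- below.
  (⨆ c : ℚ, if q ∈ limsupSlopeSet f c then ((c : ℝ) : EReal) else ⊥).toReal

theorem measurable_upperSlope [SecondCountableTopology X] [MeasurableSpace X] [BorelSpace X]
    {f : X → ℝ} (hf : Continuous f) : Measurable (upperSlope f) := by
  refine Measurable.ereal_toReal (Measurable.iSup fun c => ?_)
  refine Measurable.ite ?_ measurable_const measurable_const
  exact MeasurableSet.iInter fun n => MeasurableSet.iUnion fun m =>
    (isClosed_slopeSet hf _ _ _).measurableSet

theorem extend_apply (γ : Frag X) (h : γ.dom → ℝ) (t : γ.dom) :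
    Function.extend Subtype.val h 0 (t : ℝ) = h t :=
  Subtype.val_injective.extend_apply _ _ _

theorem partialDeriv_apply (γ : Frag X) (f : X → ℝ) (t : γ.dom) :
    γ.partialDeriv f (γ t) = γ.derivOn (fun s => f (γ s)) t := by
  have h : ∃ s : γ.dom, γ s = γ t := ⟨t, rfl⟩
  rw [partialDeriv, dif_pos h, γ.injective h.choose_spec]

/-- With `m` free, the lower bound `1 / (m + 1)` only says that the increment is nonzero, while the
upper bounds `1 / (n + 1)` give a basis of neighbourhoods; injectivity of `γ` identifies the
parameter of the base point. -/
theorem mem_limsupSlopeSet_iff {γ : Frag X} {f : X → ℝ} {t : γ.dom} {c : ℝ} :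
    (γ, γ t) ∈ limsupSlopeSet f c ↔ ∃ᶠ s : ℝ in 𝓝[γ.dom \ {(t : ℝ)}] (t : ℝ),
      c ≤ slope (Function.extend Subtype.val (fun s => f (γ s)) 0) t s := by
  have key : ∀ s : γ.dom, (s : ℝ) ≠ (t : ℝ) →
      (c ≤ slope (Function.extend Subtype.val (fun s => f (γ s)) 0) t (s : ℝ) ↔
        c * ((s : ℝ) - t) ^ 2 ≤ (f (γ s) - f (γ t)) * (s - t)) := by
    intro s hs
    have hs' : 0 < ((s : ℝ) - t) ^ 2 := by
      have := sub_ne_zero.2 hs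
      positivity
    rw [slope_def_field, extend_apply, extend_apply, ← mul_le_mul_iff_left₀ hs']
    have : (f (γ s) - f (γ t)) / ((s : ℝ) - t) * ((s : ℝ) - t) ^ 2
        = (f (γ s) - f (γ t)) * (s - t) := by
      have := sub_ne_zero.2 hs
      field_simp
    rw [this]
  have hB : (𝓝[γ.dom \ {(t : ℝ)}] (t : ℝ)).HasBasis (fun _ : ℕ => True)
      fun n => Metric.closedBall (t : ℝ) (1 / (n + 1)) ∩ (γ.dom \ {(t : ℝ)}) :=
    nhdsWithin_hasBasis Metric.nhds_basis_closedBall_inv_nat_succ _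
  rw [hB.frequently_iff]
  simp only [limsupSlopeSet, mem_iInter, mem_iUnion, forall_true_left]
  refine forall_congr' fun n => ⟨?_, ?_⟩
  · rintro ⟨m, a, ⟨t', ha⟩, b, ⟨s, rfl⟩, h1, h2, h3, h4⟩
    rw [γ.injective ((congrArg Prod.snd ha).trans h1)] at ha
    subst ha
    have hne : (s : ℝ) ≠ t := by
      rintro h
      simp only [h, sub_self, abs_zero] at h2
      exact absurd h2 (not_le.2 (by positivity))
    exact ⟨s, ⟨by simpa [Real.dist_eq] using h3, s.2, hne⟩, (key s hne).2 h4⟩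
  · rintro ⟨s, ⟨h1, h2, h3⟩, h4⟩
    obtain ⟨m, hm⟩ := exists_nat_one_div_lt (abs_pos.2 (sub_ne_zero.2 h3))
    exact ⟨m, (t, γ t), ⟨t, rfl⟩, (s, γ ⟨s, h2⟩), ⟨⟨s, h2⟩, rfl⟩, rfl, hm.le,
      by simpa [Real.dist_eq] using h1, (key ⟨s, h2⟩ h3).1 h4⟩

open Classical in
-- If the quotients converge to `d`, they are frequently at least `c` for every `c < d` and for no
-- `c > d`, so the supremum over rational `c` is `d`. The accumulation hypothesis makes the
-- punctured filter nontrivial, which the case `c < d` uses.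
theorem upperSlope_eq_partialDeriv {γ : Frag X} {f : X → ℝ} {t : γ.dom}
    (hd : DifferentiableWithinAt ℝ (Function.extend Subtype.val (fun s => f (γ s)) 0) γ.dom t)
    (ht : AccPt (t : ℝ) (𝓟 γ.dom)) : upperSlope f (γ, γ t) = γ.partialDeriv f (γ t) := by
  rw [partialDeriv_apply]
  have hlim := hasDerivWithinAt_iff_tendsto_slope.1 hd.hasDerivWithinAt
  change Tendsto _ _ (𝓝 (γ.derivOn (fun s => f (γ s)) t)) at hlim
  set d := γ.derivOn (fun s => f (γ s)) t
  have : (𝓝[γ.dom \ {(t : ℝ)}] (t : ℝ)).NeBot := accPt_principal_iff_nhdsWithin.1 ht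
  have h1 : ∀ c : ℝ, c < d → (γ, γ t) ∈ limsupSlopeSet f c := fun c hc =>
    mem_limsupSlopeSet_iff.2 ((hlim.eventually (lt_mem_nhds hc)).frequently.mono fun _ h => h.le)
  have h2 : ∀ c : ℝ, (γ, γ t) ∈ limsupSlopeSet f c → c ≤ d := by
    intro c hc
    by_contra! hcd
    obtain ⟨s, h3, h4⟩ :=
      ((mem_limsupSlopeSet_iff.1 hc).and_eventually (hlim.eventually (gt_mem_nhds hcd))).exists
    exact absurd h3 (not_le.2 h4)
  have hsup : (⨆ c : ℚ, if (γ, γ t) ∈ limsupSlopeSet f c then ((c : ℝ) : EReal) else ⊥)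
      = (d : EReal) := by
    refine le_antisymm (iSup_le fun c => ?_) (le_of_forall_lt fun z hz => ?_)
    · split_ifs with h
      · exact EReal.coe_le_coe_iff.2 (h2 c h)
      · exact bot_le
    · obtain ⟨c, h3, h4⟩ := EReal.exists_rat_btwn_of_lt hz
      refine h3.trans_le (le_iSup_of_le c ?_)
      rw [if_pos (h1 c (EReal.coe_lt_coe_iff.1 h4))]
  rw [upperSlope, hsup, EReal.toReal_coe]

theorem lipschitzOnWith_extend {γ : Frag X} {f : X → ℝ} {C K : ℝ≥0} (hγ : LipschitzWith C γ.toFun)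
    (hf : LipschitzWith K f) :
    LipschitzOnWith (K * C) (Function.extend Subtype.val (fun s => f (γ s)) 0) γ.dom := by
  rw [lipschitzOnWith_iff_restrict]
  convert hf.comp hγ using 1
  ext t
  exact extend_apply γ _ t

theorem abs_partialDeriv_le {γ : Frag X} {f : X → ℝ} {C : ℝ≥0} {K : ℝ≥0}
    (hγ : LipschitzWith C γ.toFun) (hf : LipschitzWith K f) (x : X) :
    |γ.partialDeriv f x| ≤ K * C := by
  by_cases h : ∃ t : γ.dom, γ t = x
  · obtain ⟨t, rfl⟩ := h
    rw [partialDeriv_apply, derivOn]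
    have h0 : (0 : ℝ) ≤ K * C := by positivity
    by_cases hd : DifferentiableWithinAt ℝ
      (Function.extend Subtype.val (fun s => f (γ s)) 0) γ.dom t
    swap
    · rwa [derivWithin_zero_of_not_differentiableWithinAt hd, abs_zero]
    by_cases ht : AccPt (t : ℝ) (𝓟 γ.dom)
    swap
    · rwa [derivWithin_zero_of_not_accPt ht, abs_zero]
    have : (𝓝[γ.dom \ {(t : ℝ)}] (t : ℝ)).NeBot := accPt_principal_iff_nhdsWithin.1 ht
    refine le_of_tendsto (hasDerivWithinAt_iff_tendsto_slope.1 hd.hasDerivWithinAt).abs ?_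
    filter_upwards [self_mem_nhdsWithin] with s hs
    have h1 := (lipschitzOnWith_extend hγ hf).dist_le_mul s hs.1 t t.2
    rw [Real.dist_eq, Real.dist_eq, NNReal.coe_mul] at h1
    rwa [slope_def_field, abs_div, div_le_iff₀ (abs_pos.2 (sub_ne_zero.2 hs.2))]
  · rw [partialDeriv, dif_neg h, abs_zero]
    positivity

end

section
variable {X : Type*} [MetricSpace X] [MeasurableSpace X] [BorelSpace X]

/-- Exceptional parameters form a Lebesgue-null set, that is, an `H¹`-null one, and a Lipschitz map
sends it to an `H¹`-null set, which `ν` does not charge. -/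
theorem ae_exists_of_ae (γ : Frag X) {ν : Measure X}
    (hν : ν ≪ (Measure.hausdorffMeasure 1).restrict γ.im) {p : ℝ → Prop}
    (hp : ∀ᵐ t, t ∈ γ.dom → p t) : ∀ᵐ x ∂ν, ∃ t : γ.dom, γ t = x ∧ p t := by
  suffices h : ∀ᵐ x ∂(Measure.hausdorffMeasure 1).restrict γ.im, ∃ t : γ.dom, γ t = x ∧ p t from
    hν.ae_le h
  obtain ⟨L, hL⟩ := γ.lipschitz
  have him : MeasurableSet γ.im := γ.measurableEmbedding.measurableSet_range
  rw [ae_restrict_iff' him, ae_iff]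
  have h0 : Measure.hausdorffMeasure (X := γ.dom) 1 {t | ¬ p t} = 0 := by
    rw [← (isometry_subtype_coe (s := γ.dom)).hausdorffMeasure_image (Or.inl zero_le_one),
      hausdorffMeasure_real]
    refine measure_mono_null ?_ hp
    rintro _ ⟨t, ht, rfl⟩ h
    exact ht (h t.2)
  have h1 := hL.hausdorffMeasure_image_le zero_le_one {t | ¬ p t}
  rw [h0, mul_zero, nonpos_iff_eq_zero] at h1
  refine measure_mono_null ?_ h1
  intro x hx
  simp only [mem_ofPred_eq, not_forall] at hx
  obtain ⟨⟨t, rfl⟩, hx⟩ := hx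
  exact ⟨t, fun h => hx ⟨t, rfl, h⟩, rfl⟩

/-- The points of `K` isolated from the right are countable, and they include all isolated points.
-/
theorem ae_accPt (K : Set ℝ) : ∀ᵐ t, t ∈ K → AccPt t (𝓟 K) := by
  refine ae_iff.2 (measure_mono_null ?_
    ((countable_setOfPred_isolated_right_within (s := K)).measure_zero _))
  intro t ht
  simp only [mem_ofPred_eq, not_forall] at ht
  obtain ⟨h1, h2⟩ := ht
  refine ⟨h1, ?_⟩
  by_contra h3
  refine h2 (accPt_principal_iff_nhdsWithin.2 ?_)
  have : (𝓝[K ∩ Ioi t] t).NeBot := ⟨h3⟩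
  exact this.mono (nhdsWithin_mono _ fun s hs => ⟨hs.1, (ne_of_gt hs.2)⟩)

/-- The derivative of a Lipschitz function along a fragment exists almost everywhere. -/
theorem ae_differentiableWithinAt (γ : Frag X) {ν : Measure X}
    (hν : ν ≪ (Measure.hausdorffMeasure 1).restrict γ.im) {f : X → ℝ} {K : ℝ≥0}
    (hf : LipschitzWith K f) : ∀ᵐ x ∂ν, ∃ t : γ.dom, γ t = x ∧
      DifferentiableWithinAt ℝ (Function.extend Subtype.val (fun s => f (γ s)) 0) γ.dom t ∧
      AccPt (t : ℝ) (𝓟 γ.dom) := by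
  obtain ⟨C, hC⟩ := γ.lipschitz
  refine γ.ae_exists_of_ae hν (p := fun t => DifferentiableWithinAt ℝ
    (Function.extend Subtype.val (fun s => f (γ s)) 0) γ.dom t ∧ AccPt t (𝓟 γ.dom)) ?_
  filter_upwards [(lipschitzOnWith_extend hC hf).ae_differentiableWithinAt_of_mem_real,
    ae_accPt γ.dom] with t h1 h2 ht
  exact ⟨h1 ht, h2 ht⟩

theorem upperSlope_ae_eq (γ : Frag X) {ν : Measure X}
    (hν : ν ≪ (Measure.hausdorffMeasure 1).restrict γ.im) {f : X → ℝ} {K : ℝ≥0}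
    (hf : LipschitzWith K f) : (fun x => upperSlope f (γ, x)) =ᵐ[ν] γ.partialDeriv f := by
  filter_upwards [γ.ae_differentiableWithinAt hν hf] with x hx
  obtain ⟨t, rfl, h1, h2⟩ := hx
  exact upperSlope_eq_partialDeriv h1 h2

end
end Frag

/-! ### Disintegration of bounded functions over a marginal -/

/-- This is the conditional expectation of `v` given the second coordinate. Since `0 ≤ v + C ≤ 2C`,
the marginal `ρ` of `(v + C) m` is at most `2C μ`; its density, shifted back by `C`, has values in
`[-C, C]`. -/
theorem exists_memLp_top_integral_eq {Ω X : Type*} [MeasurableSpace Ω] [MeasurableSpace X]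
    {m : Measure (Ω × X)} {μ : Measure X} [SigmaFinite μ] (hm : m.snd = μ) {v : Ω × X → ℝ}
    (hv : Measurable v) {C : ℝ} (hC : 0 ≤ C) (hb : ∀ᵐ p ∂m, |v p| ≤ C) :
    ∃ u : Lp ℝ ∞ μ, ‖u‖ ≤ C ∧
      ∀ g : X → ℝ, Integrable g μ → ∫ x, g x * u x ∂μ = ∫ p, g p.2 * v p ∂m := by
  have hd : Measurable fun p => ENNReal.ofReal (v p + C) := (hv.add_const C).ennreal_ofReal
  set ρ := (m.withDensity fun p => ENNReal.ofReal (v p + C)).snd with hρ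
  have hle : ∀ s, MeasurableSet s → ρ s ≤ ENNReal.ofReal (2 * C) * μ s := by
    intro s hs
    rw [hρ, Measure.snd_apply hs, withDensity_apply _ (measurable_snd hs), ← hm,
      Measure.snd_apply hs]
    calc ∫⁻ p in Prod.snd ⁻¹' s, ENNReal.ofReal (v p + C) ∂m
        ≤ ∫⁻ _ in Prod.snd ⁻¹' s, ENNReal.ofReal (2 * C) ∂m := by
          refine lintegral_mono_ae (ae_restrict_of_ae ?_)
          filter_upwards [hb] with p hp
          exact ENNReal.ofReal_le_ofReal (by linarith [(abs_le.1 hp).2])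
      _ = _ := by rw [setLIntegral_const]
  have hle' : ρ ≤ (2 * C).toNNReal • μ := Measure.le_iff.2 hle
  have hac : ρ ≪ μ := (Measure.absolutelyContinuous_of_le hle').trans
    (Measure.smul_absolutelyContinuous)
  have : SigmaFinite ρ := Measure.sigmaFinite_of_le _ hle'
  have hw := Measure.withDensity_rnDeriv_eq ρ μ hac
  set w := ρ.rnDeriv μ
  have hwm : Measurable w := Measure.measurable_rnDeriv _ _
  have hwb : ∀ᵐ x ∂μ, w x ≤ ENNReal.ofReal (2 * C) := by
    refine ae_le_of_forall_setLIntegral_le_of_sigmaFinite hwm fun s hs _ => ?_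
    rw [← withDensity_apply _ hs, hw, setLIntegral_const]
    exact hle s hs
  have hub : ∀ᵐ x ∂μ, ‖(w x).toReal - C‖ ≤ C := by
    filter_upwards [hwb] with x hx
    have h1 := ENNReal.toReal_mono ENNReal.ofReal_ne_top hx
    rw [ENNReal.toReal_ofReal (by positivity)] at h1
    rw [Real.norm_eq_abs, abs_le]
    constructor <;> linarith [ENNReal.toReal_nonneg (a := w x)]
  have hum : AEStronglyMeasurable (fun x => (w x).toReal - C) μ :=
    (hwm.ennreal_toReal.sub_const C).aestronglyMeasurable
  have hu : MemLp (fun x => (w x).toReal - C) ∞ μ := memLp_top_of_bound hum C hub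
  refine ⟨hu.toLp, ?_, fun g hg => ?_⟩
  · rw [Lp.norm_toLp, eLpNorm_exponent_top]
    exact ENNReal.toReal_le_of_le_ofReal hC (eLpNormEssSup_le_of_ae_bound hub)
  have hgm : Integrable (fun p : Ω × X => g p.2) m := by
    rw [← hm, Measure.snd] at hg
    exact hg.comp_measurable measurable_snd
  have hgv : Integrable (fun p : Ω × X => g p.2 * v p) m := by
    simpa [mul_comm] using hgm.bdd_mul hv.aestronglyMeasurable hb
  have h1 : ∫ x, g x * (w x).toReal ∂μ = ∫ p, g p.2 * (v p + C) ∂m := by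
    have h2 := integral_withDensity_eq_integral_toReal_smul hwm
      (hwb.mono fun x hx => hx.trans_lt ENNReal.ofReal_lt_top) g
    rw [hw, hρ, Measure.snd, integral_map measurable_snd.aemeasurable,
      integral_withDensity_eq_integral_toReal_smul hd (by simp)] at h2
    · simp only [smul_eq_mul] at h2
      simp only [mul_comm (g _), ← h2]
      refine integral_congr_ae ?_
      filter_upwards [hb] with p hp
      rw [ENNReal.toReal_ofReal (by linarith [(abs_le.1 hp).1])]
    · exact hg.aestronglyMeasurable.mono_ac hac
  have hgw : Integrable (fun x => g x * (w x).toReal) μ := by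
    have h3 : ∀ᵐ x ∂μ, ‖(w x).toReal‖ ≤ 2 * C := by
      filter_upwards [hub] with x hx
      rw [Real.norm_eq_abs, abs_le] at *
      constructor <;> linarith
    simpa [mul_comm] using hg.bdd_mul hwm.ennreal_toReal.aestronglyMeasurable h3
  calc ∫ x, g x * hu.toLp _ x ∂μ = ∫ x, (g x * (w x).toReal - g x * C) ∂μ := by
        refine integral_congr_ae ?_
        filter_upwards [hu.coeFn_toLp] with x hx
        rw [hx, mul_sub]
    _ = ∫ p, g p.2 * (v p + C) ∂m - ∫ p, g p.2 * C ∂m := by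
        rw [integral_sub hgw (hg.mul_const C), h1]
        congr 1
        rw [← hm, Measure.snd, integral_map measurable_snd.aemeasurable]
        rw [← Measure.snd, hm]
        exact (hg.mul_const C).aestronglyMeasurable
    _ = _ := by
        rw [← integral_sub _ (hgm.mul_const C)]
        · simp [mul_add]
        · simp only [mul_add]
          exact hgv.add (hgm.mul_const C)

theorem Lp_top_ext_of_integral_eq {X : Type*} [MeasurableSpace X] {μ : Measure X} [SigmaFinite μ]
    {u v : Lp ℝ ∞ μ}
    (h : ∀ g : X → ℝ, Measurable g → (∃ M : ℝ, ∀ x, |g x| ≤ M) → Integrable g μ →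
      ∫ x, g x * u x ∂μ = ∫ x, g x * v x ∂μ) : u = v := by
  have hi : ∀ (w : Lp ℝ ∞ μ) s, MeasurableSet s → μ s < ∞ → IntegrableOn w s μ := by
    intro w s hs hμ
    have : IsFiniteMeasure (μ.restrict s) := ⟨by simpa using hμ⟩
    exact ((Lp.memLp w).restrict s).integrable le_top
  refine Lp.ext (ae_eq_of_forall_setIntegral_eq_of_sigmaFinite (hi u) (hi v) fun s hs hμ => ?_)
  have h1 := h (s.indicator 1) (measurable_one.indicator hs) ⟨1, fun x => by
    by_cases hx : x ∈ s <;> simp [hx]⟩ ((integrable_indicator_iff hs).2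
      (integrableOn_const hμ.ne))
  rw [← integral_indicator hs, ← integral_indicator hs]
  convert h1 using 2 <;> ext x <;> by_cases hx : x ∈ s <;> simp [hx]

/-! ### Algebraic properties of the derivative along a fragment -/

namespace LipB

variable {X : Type*} [MetricSpace X]

theorem lipschitzWith (f : LipB X) : LipschitzWith ‖f‖₊ f :=
  LipschitzWith.of_dist_le_mul fun x y => (f.glip_mem.2 x y).trans <| by
    rw [coe_nnnorm, norm_def]
    exact mul_le_mul_of_nonneg_right (le_max_right _ _) dist_nonneg

end LipB

namespace Frag

variable {X : Type*} [MetricSpace X]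

section
variable (γ : Frag X)

theorem partialDeriv_smul (c : ℝ) (f : LipB X) :
    γ.partialDeriv (c • f : LipB X) = fun x => c * γ.partialDeriv f x := by
  ext x
  by_cases hx : ∃ t : γ.dom, γ t = x
  · obtain ⟨t, rfl⟩ := hx
    simp only [partialDeriv_apply, derivOn]
    rw [← smul_eq_mul, ← derivWithin_const_smul_field, ← Function.extend_smul, smul_zero]
    rfl
  · rw [partialDeriv, partialDeriv, dif_neg hx, dif_neg hx, mul_zero]

variable [MeasurableSpace X] [BorelSpace X] {ν : Measure X}

theorem partialDeriv_add_ae (hν : ν ≪ (Measure.hausdorffMeasure 1).restrict γ.im) (f g : LipB X) :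
    γ.partialDeriv (f + g : LipB X) =ᵐ[ν] fun x => γ.partialDeriv f x + γ.partialDeriv g x := by
  filter_upwards [γ.ae_differentiableWithinAt hν f.lipschitzWith,
    γ.ae_differentiableWithinAt hν g.lipschitzWith] with x h1 h2
  obtain ⟨t, rfl, hf, -⟩ := h1
  obtain ⟨s, hst, hg, -⟩ := h2
  obtain rfl := γ.injective hst
  simp only [partialDeriv_apply, derivOn]
  rw [← derivWithin_add hf hg, ← Function.extend_add, add_zero]
  rfl

theorem partialDeriv_mul_ae (hν : ν ≪ (Measure.hausdorffMeasure 1).restrict γ.im) (f g : LipB X) :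
    γ.partialDeriv (f * g : LipB X) =ᵐ[ν]
      fun x => f x * γ.partialDeriv g x + g x * γ.partialDeriv f x := by
  filter_upwards [γ.ae_differentiableWithinAt hν f.lipschitzWith,
    γ.ae_differentiableWithinAt hν g.lipschitzWith] with x h1 h2
  obtain ⟨t, rfl, hf, -⟩ := h1
  obtain ⟨s, hst, hg, -⟩ := h2
  obtain rfl := γ.injective hst
  simp only [partialDeriv_apply, derivOn]
  have h := derivWithin_mul hf hg
  rw [← Function.extend_mul, mul_zero, extend_apply, extend_apply] at h
  rw [add_comm, mul_comm (g _)]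
  refine Eq.trans ?_ (h.trans (by ring))
  rfl

end
end Frag

/-! ### Weak derivatives of curves of point evaluations -/

section Approx
variable {X : Type*} [MetricSpace X]

/-- The functional `f ↦ ∫ w (F f)'` is a norm limit of linear combinations of point evaluations. -/
def IsSpanApprox (F : LipB X → ℝ → ℝ) (w : ℝ → ℝ) : Prop :=
  ∀ ε > 0, ∃ φ ∈ Submodule.span ℝ (range (LipB.pointEval (X := X))), ∀ f : LipB X,
    |(∫ t, w t * deriv (F f) t) - φ f| ≤ ε * ‖f‖

variable {F : LipB X → ℝ → ℝ} {C : ℝ≥0} {w w' : ℝ → ℝ}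

theorem norm_deriv_le_of_lipschitzWith (hF : ∀ f, LipschitzWith (‖f‖₊ * C) (F f)) (f : LipB X)
    (t : ℝ) : ‖deriv (F f) t‖ ≤ C * ‖f‖ := by
  simpa [mul_comm] using norm_deriv_le_of_lipschitz (x₀ := t) (hF f)

theorem integrable_mul_deriv (hF : ∀ f, LipschitzWith (‖f‖₊ * C) (F f)) (hw : Integrable w)
    (f : LipB X) : Integrable fun t => w t * deriv (F f) t := by
  simpa [mul_comm] using hw.bdd_mul (measurable_deriv (F f)).aestronglyMeasurable
    (Eventually.of_forall (norm_deriv_le_of_lipschitzWith hF f))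

theorem IsSpanApprox.of_approx (hF : ∀ f, LipschitzWith (‖f‖₊ * C) (F f)) (hw : Integrable w)
    (h : ∀ ε > 0, ∃ w', Integrable w' ∧ ∫ t, |w t - w' t| ≤ ε ∧ IsSpanApprox F w') :
    IsSpanApprox F w := by
  intro ε hε
  -- The error caused by replacing `w` is at most `C ‖f‖` times the `L¹` distance; `C + 1` keeps the
  -- denominator positive when `C = 0`.
  obtain ⟨w', hw', hww', h'⟩ := h (ε / (2 * (C + 1))) (by positivity)
  obtain ⟨φ, hφ, hφ'⟩ := h' (ε / 2) (by positivity)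
  refine ⟨φ, hφ, fun f => ?_⟩
  have h1 : |(∫ t, w t * deriv (F f) t) - ∫ t, w' t * deriv (F f) t| ≤ ε / 2 * ‖f‖ := by
    rw [← integral_sub (integrable_mul_deriv hF hw f) (integrable_mul_deriv hF hw' f)]
    calc |∫ t, (w t * deriv (F f) t - w' t * deriv (F f) t)|
        ≤ ∫ t, |w t * deriv (F f) t - w' t * deriv (F f) t| := abs_integral_le_integral_abs
      _ ≤ ∫ t, |w t - w' t| * (C * ‖f‖) := by
          refine integral_mono_of_nonneg (Eventually.of_forall fun _ => abs_nonneg _)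
            ((hw.sub hw').abs.mul_const _) (Eventually.of_forall fun t => ?_)
          simp only [← sub_mul, abs_mul]
          exact mul_le_mul_of_nonneg_left (norm_deriv_le_of_lipschitzWith hF f t) (abs_nonneg _)
      _ = (∫ t, |w t - w' t|) * (C * ‖f‖) := integral_mul_const _ _
      _ ≤ ε / (2 * (C + 1)) * ((C + 1) * ‖f‖) := by
          gcongr
          linarith
      _ = ε / 2 * ‖f‖ := by
          have : (C : ℝ) + 1 ≠ 0 := by positivity
          field_simp
  calc |(∫ t, w t * deriv (F f) t) - φ f|
      ≤ |(∫ t, w t * deriv (F f) t) - ∫ t, w' t * deriv (F f) t|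
        + |(∫ t, w' t * deriv (F f) t) - φ f| := abs_sub_le _ _ _
    _ ≤ ε / 2 * ‖f‖ + ε / 2 * ‖f‖ := add_le_add h1 (hφ' f)
    _ = ε * ‖f‖ := by ring

theorem IsSpanApprox.zero : IsSpanApprox F 0 := fun ε hε =>
  ⟨0, zero_mem _, fun f => by simpa using mul_nonneg hε.le (norm_nonneg f)⟩

theorem IsSpanApprox.add (hF : ∀ f, LipschitzWith (‖f‖₊ * C) (F f)) (hw : Integrable w)
    (hw' : Integrable w') (h : IsSpanApprox F w) (h' : IsSpanApprox F w') :
    IsSpanApprox F (w + w') := by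
  intro ε hε
  obtain ⟨φ, hφ, h1⟩ := h (ε / 2) (by positivity)
  obtain ⟨ψ, hψ, h2⟩ := h' (ε / 2) (by positivity)
  refine ⟨φ + ψ, add_mem hφ hψ, fun f => ?_⟩
  simp only [Pi.add_apply, add_mul]
  rw [integral_add (integrable_mul_deriv hF hw f) (integrable_mul_deriv hF hw' f),
    add_apply, add_sub_add_comm]
  refine (abs_add_le _ _).trans ((add_le_add (h1 f) (h2 f)).trans (by linarith))

theorem IsSpanApprox.sum (hF : ∀ f, LipschitzWith (‖f‖₊ * C) (F f)) {ι : Type*} (s : Finset ι)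
    {v : ι → ℝ → ℝ} (hv : ∀ i ∈ s, Integrable (v i)) (h : ∀ i ∈ s, IsSpanApprox F (v i)) :
    IsSpanApprox F (∑ i ∈ s, v i) := by
  classical
  induction s using Finset.induction_on with
  | empty => simpa using IsSpanApprox.zero
  | insert a s ha ih =>
    rw [Finset.sum_insert ha]
    exact IsSpanApprox.add hF (hv _ (Finset.mem_insert_self _ _))
      (integrable_finsetSum' _ fun i hi => hv i (Finset.mem_insert_of_mem hi))
      (h _ (Finset.mem_insert_self _ _))
      (ih (fun i hi => hv i (Finset.mem_insert_of_mem hi))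
        (fun i hi => h i (Finset.mem_insert_of_mem hi)))

/-- By the fundamental theorem of calculus for absolutely continuous functions, the functional is
exactly `c` times the difference of the evaluations at `y` and `x`. -/
theorem isSpanApprox_indicator_Icc (hF : ∀ f, LipschitzWith (‖f‖₊ * C) (F f)) {a b : ℝ}
    (hab : a ≤ b) {x y : X} (hx : ∀ f : LipB X, F f a = f x) (hy : ∀ f : LipB X, F f b = f y)
    (c : ℝ) : IsSpanApprox F ((Icc a b).indicator fun _ => c) := by
  intro ε hε
  refine ⟨c • (LipB.pointEval y - LipB.pointEval x), Submodule.smul_mem _ _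
    (sub_mem (Submodule.subset_span ⟨y, rfl⟩) (Submodule.subset_span ⟨x, rfl⟩)), fun f => ?_⟩
  have h1 := ((hF f).lipschitzOnWith (s := uIcc a b)).absolutelyContinuousOnInterval
    |>.integral_deriv_eq_sub
  rw [intervalIntegral.integral_of_le hab, ← integral_Icc_eq_integral_Ioc, hx, hy] at h1
  have h2 : (fun t => (Icc a b).indicator (fun _ => c) t * deriv (F f) t)
      = (Icc a b).indicator fun t => c * deriv (F f) t := by
    ext t
    by_cases ht : t ∈ Icc a b <;> simp [ht]
  rw [h2, integral_indicator measurableSet_Icc, integral_const_mul, h1]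
  have h3 : (c • (LipB.pointEval y - LipB.pointEval x)) f = c * (f y - f x) := rfl
  rw [h3, sub_self, abs_zero]
  positivity

end Approx

/-! ### Step functions adapted to a compact set -/

section Grid

/-- The interval spanned by the part of `K` in the `i`-th cell of the grid of size `1 / (m + 1)`. -/
def cellHull (K : Set ℝ) (m : ℕ) (i : ℤ) : Set ℝ :=
  {t | ∃ a ∈ K, ∃ b ∈ K, (i : ℝ) ≤ a * (m + 1) ∧ b * (m + 1) ≤ i + 1 ∧ a ≤ t ∧ t ≤ b}

variable {K : Set ℝ}

/-- Compactness provides a least and a greatest point of `K` in the closed cell. That these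
endpoints belong to `K` is what later makes the increments of `F f` differences of point
evaluations. -/
theorem cellHull_eq_empty_or_Icc (hK : IsCompact K) (m : ℕ) (i : ℤ) :
    cellHull K m i = ∅ ∨ ∃ a ∈ K, ∃ b ∈ K, a ≤ b ∧ cellHull K m i = Icc a b := by
  rcases (cellHull K m i).eq_empty_or_nonempty with h | ⟨t, a, ha, b, hb, h1, h2, h3, h4⟩
  · exact Or.inl h
  right
  have hm : (0 : ℝ) < m + 1 := by positivity
  have hS : IsCompact (K ∩ {s | (i : ℝ) ≤ s * (m + 1) ∧ s * (m + 1) ≤ i + 1}) :=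
    hK.inter_right <| by
      simp only [ofPred_and]
      refine (isClosed_le ?_ ?_).inter (isClosed_le ?_ ?_) <;> fun_prop
  have hab : a * (m + 1) ≤ b * (m + 1) := mul_le_mul_of_nonneg_right (h3.trans h4) hm.le
  have hne : (K ∩ {s | (i : ℝ) ≤ s * (m + 1) ∧ s * (m + 1) ≤ i + 1}).Nonempty :=
    ⟨a, ha, h1, hab.trans h2⟩
  obtain ⟨a', ha', hamin⟩ := hS.exists_isLeast hne
  obtain ⟨b', hb', hbmax⟩ := hS.exists_isGreatest hne
  refine ⟨a', ha'.1, b', hb'.1, hamin hb', ?_⟩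
  ext s
  constructor
  · rintro ⟨p, hp, q, hq, h5, h6, h7, h8⟩
    have hpq : p * (m + 1) ≤ q * (m + 1) := mul_le_mul_of_nonneg_right (h7.trans h8) hm.le
    exact ⟨(hamin ⟨hp, h5, hpq.trans h6⟩).trans h7, h8.trans (hbmax ⟨hq, h5.trans hpq, h6⟩)⟩
  · rintro ⟨h5, h6⟩
    exact ⟨a', ha'.1, b', hb'.1, ha'.2.1, hb'.2.2, h5, h6⟩

theorem measurableSet_cellHull (hK : IsCompact K) (m : ℕ) (i : ℤ) :
    MeasurableSet (cellHull K m i) := by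
  rcases cellHull_eq_empty_or_Icc hK m i with h | ⟨a, -, b, -, -, h⟩ <;> rw [h]
  exacts [MeasurableSet.empty, measurableSet_Icc]

/-- Neighbouring closed cells share a grid point, which is rational; excluding the null set of
rationals makes the cell of `t` unique for all `m` at once. -/
theorem floor_eq_of_mem_cellHull {m : ℕ} {i : ℤ} {t : ℝ} (ht : t ∉ range ((↑) : ℚ → ℝ))
    (h : t ∈ cellHull K m i) : ⌊t * (m + 1)⌋ = i := by
  obtain ⟨a, ha, b, hb, h1, h2, h3, h4⟩ := h
  have hm : (0 : ℝ) < m + 1 := by positivity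
  rw [Int.floor_eq_iff]
  refine ⟨h1.trans (by gcongr), lt_of_le_of_ne ((by gcongr : t * (m + 1) ≤ b * (m + 1)).trans h2) ?_⟩
  intro h5
  refine ht ⟨(i + 1) / (m + 1), ?_⟩
  push_cast
  rw [← h5]
  field_simp

theorem mem_cellHull_floor {m : ℕ} {t : ℝ} (ht : t ∈ K) : t ∈ cellHull K m ⌊t * (m + 1)⌋ :=
  ⟨t, ht, t, ht, Int.floor_le _, (Int.lt_floor_add_one _).le, le_rfl, le_rfl⟩

/-- The step function with value `w (i / (m + 1))` on the hull of the `i`-th cell. -/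
noncomputable def gridStep (K : Set ℝ) (w : ℝ → ℝ) (R : ℝ) (m : ℕ) : ℝ → ℝ :=
  ∑ i ∈ Finset.Icc ⌊-R * (m + 1)⌋ ⌊R * (m + 1)⌋,
    (cellHull K m i).indicator fun _ => w (i / (m + 1))

theorem gridStep_apply_of_mem {w : ℝ → ℝ} {R : ℝ} (hR : K ⊆ Icc (-R) R) {m : ℕ} {t : ℝ}
    (ht : t ∉ range ((↑) : ℚ → ℝ)) (htm : t ∈ cellHull K m ⌊t * (m + 1)⌋) :
    gridStep K w R m t = w (⌊t * (m + 1)⌋ / (m + 1)) := by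
  rw [gridStep, Finset.sum_apply, Finset.sum_eq_single ⌊t * (m + 1)⌋]
  · rw [indicator_of_mem htm]
  · intro i _ hi
    exact indicator_of_notMem (fun h => hi (floor_eq_of_mem_cellHull ht h).symm) _
  · intro h
    obtain ⟨a, ha, b, hb, h1, h2, h3, h4⟩ := htm
    refine absurd (Finset.mem_Icc.2 ⟨?_, ?_⟩) h
    · exact Int.floor_le_floor (by gcongr; exact (hR ha).1.trans h3)
    · exact Int.floor_le_floor (by gcongr; exact h4.trans (hR hb).2)

theorem gridStep_apply_of_notMem {w : ℝ → ℝ} {R : ℝ} {m : ℕ} {t : ℝ}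
    (ht : t ∉ range ((↑) : ℚ → ℝ)) (htm : t ∉ cellHull K m ⌊t * (m + 1)⌋) :
    gridStep K w R m t = 0 := by
  rw [gridStep, Finset.sum_apply]
  refine Finset.sum_eq_zero fun i _ => indicator_of_notMem (fun h => htm ?_) _
  rwa [floor_eq_of_mem_cellHull ht h]

theorem abs_gridStep_le {w : ℝ → ℝ} {R W : ℝ} (hR : K ⊆ Icc (-R) R) (hW : ∀ t, |w t| ≤ W)
    {m : ℕ} {t : ℝ} (ht : t ∉ range ((↑) : ℚ → ℝ)) :
    |gridStep K w R m t| ≤ (Icc (-R) R).indicator (fun _ => W) t := by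
  have hW0 : 0 ≤ W := (abs_nonneg _).trans (hW 0)
  by_cases htm : t ∈ cellHull K m ⌊t * (m + 1)⌋
  · rw [gridStep_apply_of_mem hR ht htm]
    obtain ⟨a, ha, b, hb, h1, h2, h3, h4⟩ := htm
    rw [indicator_of_mem (show t ∈ Icc (-R) R from ⟨(hR ha).1.trans h3, h4.trans (hR hb).2⟩)]
    exact hW _
  · rw [gridStep_apply_of_notMem ht htm, abs_zero]
    exact indicator_nonneg (fun _ _ => hW0) _

/-- On `K` the step function samples `w` within `1 / (m + 1)` of `t`. Off `K`, a hull may bridge a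
gap containing `t`, but then `K` has a point within `1 / (m + 1)` of `t`, which stops for large `m`
because `K` is closed. -/
theorem tendsto_gridStep (hK : IsCompact K) {w : ℝ → ℝ} (hw : Continuous w) {R : ℝ}
    (hR : K ⊆ Icc (-R) R) {t : ℝ} (ht : t ∉ range ((↑) : ℚ → ℝ)) :
    Tendsto (fun m => gridStep K w R m t) atTop (𝓝 (K.indicator w t)) := by
  have hlim : Tendsto (fun m : ℕ => 1 / ((m : ℝ) + 1)) atTop (𝓝 0) :=
    tendsto_one_div_add_atTop_nhds_zero_nat
  by_cases htK : t ∈ K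
  · rw [indicator_of_mem htK]
    simp only [gridStep_apply_of_mem hR ht (mem_cellHull_floor htK)]
    refine (hw.tendsto t).comp (tendsto_iff_dist_tendsto_zero.2 ?_)
    refine squeeze_zero (fun _ => dist_nonneg) (fun m => ?_) hlim
    have hm : (0 : ℝ) < m + 1 := by positivity
    rw [Real.dist_eq, div_sub' hm.ne', abs_div, abs_of_pos hm]
    gcongr
    rw [abs_le]
    constructor <;> linarith [Int.floor_le (t * (m + 1)), Int.lt_floor_add_one (t * ((m : ℝ) + 1))]
  · rw [indicator_of_notMem htK]
    obtain ⟨δ, hδ, hball⟩ := Metric.isOpen_iff.1 hK.isClosed.isOpen_compl t htK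
    refine tendsto_const_nhds.congr' ?_
    filter_upwards [hlim.eventually (gt_mem_nhds hδ)] with m hm
    rw [gridStep_apply_of_notMem ht]
    rintro ⟨a, ha, b, hb, h1, h2, h3, h4⟩
    have hm0 : (0 : ℝ) < m + 1 := by positivity
    refine hball ?_ ha
    rw [Metric.mem_ball, Real.dist_eq, abs_sub_comm, abs_of_nonneg (by linarith)]
    refine lt_of_le_of_lt ?_ hm
    rw [le_div_iff₀ hm0]
    have : t * (m + 1) ≤ b * (m + 1) := by gcongr
    linarith

theorem integrable_gridStep (hK : IsCompact K) (w : ℝ → ℝ) (R : ℝ) (m : ℕ) :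
    Integrable (gridStep K w R m) := by
  refine integrable_finsetSum' _ fun i _ => ?_
  rw [integrable_indicator_iff (measurableSet_cellHull hK m i)]
  rcases cellHull_eq_empty_or_Icc hK m i with h | ⟨a, -, b, -, -, h⟩ <;> rw [h]
  · exact integrableOn_empty
  · exact integrableOn_const (by simp)

theorem tendsto_integral_gridStep (hK : IsCompact K) {w : ℝ → ℝ} (hw : Continuous w)
    (hwc : HasCompactSupport w) {R : ℝ} (hR : K ⊆ Icc (-R) R) :
    Tendsto (fun m => ∫ t, |K.indicator w t - gridStep K w R m t|) atTop (𝓝 0) := by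
  obtain ⟨W, hW⟩ := hw.bounded_above_of_compact_support hwc
  have hirr : ∀ᵐ t : ℝ, t ∉ range ((↑) : ℚ → ℝ) := (countable_range _).ae_notMem _
  have hwi : Integrable (K.indicator w) :=
    (hw.integrable_of_hasCompactSupport hwc).indicator hK.measurableSet
  rw [← integral_zero ℝ ℝ]
  refine tendsto_integral_of_dominated_convergence
    (fun t => |K.indicator w t| + (Icc (-R) R).indicator (fun _ => W) t)
    (fun m => (hwi.sub (integrable_gridStep hK w R m)).abs.aestronglyMeasurable)
    (hwi.abs.add ((integrable_indicator_iff measurableSet_Icc).2 (integrableOn_const (by simp))))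
    (fun m => ?_) ?_
  · filter_upwards [hirr] with t ht
    rw [Real.norm_eq_abs, abs_abs]
    exact (abs_sub _ _).trans (add_le_add le_rfl (abs_gridStep_le hR hW ht))
  · filter_upwards [hirr] with t ht
    simpa using ((tendsto_gridStep hK hw hR ht).const_sub (K.indicator w t)).abs

end Grid

/-! ### Membership in the predual -/

section Predual
variable {X : Type*} [MetricSpace X]

/-- Two `L¹` approximations: of `w` by a continuous compactly supported function, then of its
restriction to `K` by step functions on cell hulls. -/
theorem isSpanApprox_indicator {F : LipB X → ℝ → ℝ} {C : ℝ≥0} {K : Set ℝ} {w : ℝ → ℝ}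
    (hF : ∀ f, LipschitzWith (‖f‖₊ * C) (F f)) (hK : IsCompact K)
    (hFK : ∀ t ∈ K, ∃ x : X, ∀ f : LipB X, F f t = f x) (hw : Integrable w) :
    IsSpanApprox F (K.indicator w) := by
  obtain ⟨R, hR⟩ := hK.isBounded.subset_closedBall 0
  rw [Real.closedBall_eq_Icc, zero_sub, zero_add] at hR
  refine IsSpanApprox.of_approx hF (hw.indicator hK.measurableSet) fun ε hε => ?_
  obtain ⟨w', hw'c, hww', hw'cont, hw'i⟩ := hw.exists_hasCompactSupport_integral_sub_le hε
  refine ⟨K.indicator w', hw'i.indicator hK.measurableSet, ?_, ?_⟩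
  · refine le_trans (integral_mono_of_nonneg (Eventually.of_forall fun _ => abs_nonneg _)
      (hw.sub hw'i).abs (Eventually.of_forall fun t => ?_)) hww'
    by_cases ht : t ∈ K <;> simp [ht]
  refine IsSpanApprox.of_approx hF (hw'i.indicator hK.measurableSet) fun δ hδ => ?_
  obtain ⟨m, hm⟩ := ((tendsto_integral_gridStep hK hw'cont hw'c hR).eventually
    (gt_mem_nhds hδ)).exists
  refine ⟨_, integrable_gridStep hK w' R m, hm.le, ?_⟩
  have key : ∀ i : ℤ, ∀ c : ℝ, Integrable ((cellHull K m i).indicator fun _ => c) ∧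
      IsSpanApprox F ((cellHull K m i).indicator fun _ => c) := by
    intro i c
    rcases cellHull_eq_empty_or_Icc hK m i with h | ⟨a, ha, b, hb, hab, h⟩ <;> rw [h]
    · rw [indicator_empty]
      exact ⟨integrable_zero _ _ _, IsSpanApprox.zero⟩
    · obtain ⟨x, hx⟩ := hFK a ha
      obtain ⟨y, hy⟩ := hFK b hb
      exact ⟨(integrable_indicator_iff measurableSet_Icc).2 (integrableOn_const (by simp)),
        isSpanApprox_indicator_Icc hF hab hx hy c⟩
  exact IsSpanApprox.sum hF _ (fun i _ => (key i _).1) (fun i _ => (key i _).2)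

theorem IsSpanApprox.mem_predual {F : LipB X → ℝ → ℝ} {w : ℝ → ℝ} (h : IsSpanApprox F w)
    {φ : StrongDual ℝ (LipB X)} (hφ : ∀ f, φ f = ∫ t, w t * deriv (F f) t) :
    φ ∈ LipB.predual X := by
  rw [LipB.predual, ← SetLike.mem_coe, Submodule.topologicalClosure_coe, Metric.mem_closure_iff]
  intro ε hε
  obtain ⟨ψ, hψ, h1⟩ := h (ε / 2) (by positivity)
  refine ⟨ψ, hψ, ?_⟩
  rw [dist_eq_norm]
  refine lt_of_le_of_lt (ContinuousLinearMap.opNorm_le_bound _ (by positivity) fun f => ?_)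
    (half_lt_self hε)
  rw [sub_apply, hφ]
  exact h1 f

end Predual

namespace Frag

variable {X : Type*} [MetricSpace X] (γ : Frag X)

theorem exists_lipschitz_extension {C : ℝ≥0} (hC : LipschitzWith C γ.toFun) (f : LipB X) :
    ∃ F : ℝ → ℝ, LipschitzWith (‖f‖₊ * C) F ∧ ∀ t : γ.dom, F t = f (γ t) := by
  obtain ⟨F, hF, hFf⟩ := (lipschitzOnWith_extend hC f.lipschitzWith).extend_real
  exact ⟨F, hF, fun t => by rw [← hFf t.2, extend_apply]⟩

theorem derivOn_eq_deriv {h : γ.dom → ℝ} {F : ℝ → ℝ} {t : γ.dom} (hF : ∀ s : γ.dom, F s = h s)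
    (hd : DifferentiableAt ℝ F t) (ht : AccPt (t : ℝ) (𝓟 γ.dom)) : γ.derivOn h t = deriv F t := by
  have h1 : EqOn (Function.extend Subtype.val h 0) F γ.dom := fun s hs => by
    rw [hF ⟨s, hs⟩]
    exact γ.extend_apply h ⟨s, hs⟩
  rw [derivOn, derivWithin_congr h1 (h1 t.2)]
  exact hd.derivWithin (uniqueDiffWithinAt_iff_accPt.2 ht)

variable [MeasurableSpace X] [BorelSpace X] {ν : Measure X}

theorem pullMeasure_map (hν : ν ≪ (Measure.hausdorffMeasure 1).restrict γ.im) :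
    (γ.pullMeasure ν).map γ = ν := by
  have him : MeasurableSet γ.im := γ.measurableEmbedding.measurableSet_range
  rw [pullMeasure, γ.measurableEmbedding.map_comap]
  refine Measure.restrict_eq_self_of_ae_mem (hν.ae_le ?_)
  exact ae_restrict_mem him

theorem ae_pullMeasure (hν : ν ≪ (Measure.hausdorffMeasure 1).restrict γ.im) {p : X → Prop}
    (hp : ∀ᵐ x ∂ν, p x) : ∀ᵐ t ∂γ.pullMeasure ν, p (γ t) := by
  rw [← γ.pullMeasure_map hν] at hp
  exact γ.measurableEmbedding.ae_map_iff.1 hp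

theorem pullMeasure_map_val_absolutelyContinuous
    (hν : ν ≪ (Measure.hausdorffMeasure 1).restrict γ.im) :
    (γ.pullMeasure ν).map Subtype.val ≪ (volume : Measure ℝ) := by
  refine Measure.AbsolutelyContinuous.mk fun s hs h0 => ?_
  rw [Measure.map_apply measurable_subtype_coe hs]
  have h1 := γ.ae_pullMeasure hν (γ.ae_exists_of_ae hν (p := fun t => t ∉ s)
    ((measure_eq_zero_iff_ae_notMem.1 h0).mono fun t ht _ => ht))
  refine measure_eq_zero_iff_ae_notMem.2 (h1.mono ?_)
  rintro t ⟨s, hst, hs⟩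
  rwa [γ.injective hst] at hs

theorem integrable_mul_partialDeriv [SecondCountableTopology X]
    (hν : ν ≪ (Measure.hausdorffMeasure 1).restrict γ.im) {h : X → ℝ} (hi : Integrable h ν)
    (f : LipB X) : Integrable (fun x => h x * γ.partialDeriv f x) ν := by
  obtain ⟨C, hC⟩ := γ.lipschitz
  have hm : AEStronglyMeasurable (γ.partialDeriv f) ν :=
    (((measurable_upperSlope f.toBCF.continuous).comp
      measurable_prodMk_left).aestronglyMeasurable).congr (γ.upperSlope_ae_eq hν f.lipschitzWith)
  simpa [mul_comm] using hi.bdd_mul hm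
    (Eventually.of_forall fun x => abs_partialDeriv_le hC f.lipschitzWith x)

/-- The derivative along a fragment, integrated against an integrable weight, is an element of the
predual of the space of bounded Lipschitz functions. -/
theorem exists_mem_predual [SecondCountableTopology X] [IsFiniteMeasure ν]
    (hν : ν ≪ (Measure.hausdorffMeasure 1).restrict γ.im) {C : ℝ≥0} (hC : LipschitzWith C γ.toFun)
    {h : X → ℝ}
    (hi : Integrable h ν) :
    ∃ φ ∈ LipB.predual X, ‖φ‖ ≤ C * ∫ x, |h x| ∂ν ∧
      ∀ f : LipB X, φ f = ∫ x, h x * γ.partialDeriv f x ∂ν := by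
  have hbd : ∀ (f : LipB X) x, |γ.partialDeriv f x| ≤ ‖f‖ * C := fun f x =>
    abs_partialDeriv_le hC f.lipschitzWith x
  have hint : ∀ f : LipB X, Integrable (fun x => h x * γ.partialDeriv f x) ν :=
    γ.integrable_mul_partialDeriv hν hi
  let φ₀ : LipB X →ₗ[ℝ] ℝ :=
    { toFun := fun f => ∫ x, h x * γ.partialDeriv f x ∂ν
      map_add' := fun f g => by
        rw [← integral_add (hint f) (hint g)]
        refine integral_congr_ae ?_
        filter_upwards [γ.partialDeriv_add_ae hν f g] with x hx
        rw [hx, mul_add]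
      map_smul' := fun c f => by
        rw [RingHom.id_apply, smul_eq_mul, ← integral_const_mul, γ.partialDeriv_smul]
        simp only [mul_left_comm] }
  have hnn : 0 ≤ ∫ x, |h x| ∂ν := integral_nonneg fun _ => abs_nonneg _
  have hφ₀ : ∀ f, ‖φ₀ f‖ ≤ C * (∫ x, |h x| ∂ν) * ‖f‖ := by
    intro f
    calc ‖∫ x, h x * γ.partialDeriv f x ∂ν‖ ≤ ∫ x, |h x| * (‖f‖ * C) ∂ν := by
          refine norm_integral_le_of_norm_le (hi.abs.mul_const _)
            (Eventually.of_forall fun x => ?_)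
          rw [Real.norm_eq_abs, abs_mul]
          exact mul_le_mul_of_nonneg_left (hbd f x) (abs_nonneg _)
      _ = _ := by
          rw [integral_mul_const]
          ring
  refine ⟨φ₀.mkContinuous _ hφ₀, ?_, LinearMap.mkContinuous_norm_le _ (by positivity) _,
    fun f => rfl⟩
  -- The extensions are chosen separately for each `f` and need not be linear in `f`; only their
  -- Lipschitz constants and their values on `dom γ` are used.
  choose F hF hFγ using γ.exists_lipschitz_extension hC
  have : IsFiniteMeasure (γ.pullMeasure ν) := ⟨by
    rw [pullMeasure_apply]
    exact measure_lt_top _ _⟩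
  set n := (γ.pullMeasure ν).map Subtype.val with hn
  have hnac : n ≪ volume := γ.pullMeasure_map_val_absolutelyContinuous hν
  have hemb : MeasurableEmbedding (Subtype.val : γ.dom → ℝ) :=
    MeasurableEmbedding.subtype_coe γ.isCompact_dom.measurableSet
  have hρ := Measure.withDensity_rnDeriv_eq n volume hnac
  have hρm : Measurable (n.rnDeriv volume) := Measure.measurable_rnDeriv _ _
  have hρt : ∀ᵐ t, n.rnDeriv volume t < ∞ := Measure.rnDeriv_lt_top _ _
  set H : ℝ → ℝ := Function.extend Subtype.val (fun t => h (γ t)) 0 with hH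
  have hHi : Integrable H n := by
    rw [hn, hemb.integrable_map_iff]
    have h1 : H ∘ Subtype.val = h ∘ γ := by
      ext t
      exact γ.extend_apply (fun t => h (γ t)) t
    rw [h1, ← γ.measurableEmbedding.integrable_map_iff, γ.pullMeasure_map hν]
    exact hi
  -- The Lebesgue density of the signed measure `h dν` pulled back to the line; it vanishes off `dom
  -- γ` because `H` does.
  set w : ℝ → ℝ := fun t => (n.rnDeriv volume t).toReal * H t with hw
  have hwi : Integrable w := by
    rw [← hρ] at hHi
    exact (integrable_withDensity_iff_integrable_smul' hρm hρt).1 hHi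
  have hwK : γ.dom.indicator w = w := by
    refine indicator_eq_self.2 fun t ht => ?_
    by_contra htK
    refine ht ?_
    have : H t = 0 := Function.extend_apply' _ _ _ (by simpa using htK)
    simp [hw, this]
  have happ : IsSpanApprox F w := by
    rw [← hwK]
    exact isSpanApprox_indicator hF γ.isCompact_dom (fun t ht => ⟨γ ⟨t, ht⟩, fun f => hFγ f ⟨t, ht⟩⟩)
      hwi
  refine happ.mem_predual fun f => ?_
  change ∫ x, h x * γ.partialDeriv f x ∂ν = _
  have hgood : ∀ᵐ t ∂n, DifferentiableAt ℝ (F f) t ∧ (t ∈ γ.dom → AccPt t (𝓟 γ.dom)) :=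
    hnac.ae_le ((hF f).ae_differentiableAt_real.and (ae_accPt γ.dom))
  have hgood' := hemb.ae_map_iff.1 hgood
  calc ∫ x, h x * γ.partialDeriv f x ∂ν
      = ∫ t, h (γ t) * γ.partialDeriv f (γ t) ∂γ.pullMeasure ν := by
        conv_lhs => rw [← γ.pullMeasure_map hν, γ.measurableEmbedding.integral_map]
    _ = ∫ t : γ.dom, H t * deriv (F f) t ∂γ.pullMeasure ν := by
        refine integral_congr_ae ?_
        filter_upwards [hgood'] with t ht
        rw [hH, extend_apply, partialDeriv_apply, γ.derivOn_eq_deriv (hFγ f) ht.1 (ht.2 t.2)]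
    _ = ∫ t, H t * deriv (F f) t ∂n := by
        rw [hn, hemb.integral_map (fun t => H t * deriv (F f) t)]
    _ = ∫ t, w t * deriv (F f) t := by
        rw [← hρ, integral_withDensity_eq_integral_toReal_smul hρm hρt]
        simp [hw, mul_assoc]

end Frag

/-! ### Weakly measurable maps with values in a separable space of functionals -/

section WeaklyMeasurable
variable {V E : Type*} [NormedAddCommGroup V] [NormedSpace ℝ V] [NormedAddCommGroup E]
  [NormedSpace ℝ E] (ι : E →ₗᵢ[ℝ] StrongDual ℝ V)

theorem abs_apply_le (φ : E) {f : V} (hf : ‖f‖ ≤ 1) : |ι φ f| ≤ ‖φ‖ := by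
  rw [← ι.norm_map]
  exact ((ι φ).le_opNorm _).trans (mul_le_of_le_one_right (norm_nonneg _) hf)

/-- Vectors of the unit ball that almost attain the norms of a dense sequence of functionals also
compute the norm of every functional in `E`, by approximation. -/
theorem exists_norming_sequence [SeparableSpace E] :
    ∃ F : ℕ × ℕ → V, (∀ i, ‖F i‖ ≤ 1) ∧
      ∀ (φ : E) (r : ℝ), (∀ i, |ι φ (F i)| ≤ r) → ‖φ‖ ≤ r := by
  have h : ∀ i : ℕ × ℕ, ∃ f : V, ‖f‖ ≤ 1 ∧
      ‖denseSeq E i.1‖ - 1 / (i.2 + 1) < |ι (denseSeq E i.1) f| := by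
    intro i
    obtain ⟨f, hf, hf'⟩ := (ι (denseSeq E i.1)).exists_lt_apply_of_lt_opNorm
      (r := ‖denseSeq E i.1‖ - 1 / (i.2 + 1)) (by
        rw [ι.norm_map]
        exact sub_lt_self _ (by positivity))
    exact ⟨f, hf.le, hf'⟩
  choose F hF hF' using h
  refine ⟨F, hF, fun φ r hr => le_of_forall_pos_le_add fun ε hε => ?_⟩
  obtain ⟨k, hk⟩ := (denseRange_denseSeq E).exists_dist_lt φ (ε := ε / 3) (by positivity)
  obtain ⟨n, hn⟩ := exists_nat_one_div_lt (K := ℝ) (ε := ε / 3) (by positivity)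
  have h1 := hF' (k, n)
  simp only at h1
  set ψ := denseSeq E k
  have h2 : ‖φ - ψ‖ < ε / 3 := by rwa [← dist_eq_norm]
  have h3 : |ι (φ - ψ) (F (k, n))| ≤ ‖φ - ψ‖ :=
    abs_apply_le ι (φ - ψ) (hF _)
  have h4 : |ι ψ (F (k, n))| ≤ |ι φ (F (k, n))| + |ι (φ - ψ) (F (k, n))| := by
    have : ι ψ (F (k, n)) = ι φ (F (k, n)) - ι (φ - ψ) (F (k, n)) := by simp
    rw [this]
    exact abs_sub _ _
  have h5 : ‖φ‖ ≤ ‖ψ‖ + ‖φ - ψ‖ := by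
    simpa using norm_add_le ψ (φ - ψ)
  linarith [hr (k, n)]

/-- A weakly measurable map to a separable space of functionals is measurable. -/
theorem measurable_of_forall_apply [SeparableSpace E]
    {Ω : Type*} [MeasurableSpace Ω] {φ : Ω → E} (h : ∀ f : V, Measurable fun ω => ι (φ ω) f) :
    Measurable[_, borel E] φ := by
  let _ : MeasurableSpace E := borel E
  have : BorelSpace E := ⟨rfl⟩
  obtain ⟨F, hF, hF'⟩ := exists_norming_sequence ι
  have hball : ∀ (ψ : E) (r : ℝ), MeasurableSet (φ ⁻¹' Metric.closedBall ψ r) := by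
    intro ψ r
    -- The norming sequence turns a norm ball into countably many scalar conditions, and by
    -- separability every open set is a countable union of such balls.
    have : φ ⁻¹' Metric.closedBall ψ r = ⋂ i, {ω | |ι (φ ω) (F i) - ι ψ (F i)| ≤ r} := by
      ext ω
      simp only [mem_preimage, Metric.mem_closedBall, dist_eq_norm, mem_iInter, mem_ofPred_eq]
      refine ⟨fun h1 i => ?_, fun h1 => hF' _ _ fun i => by simpa using h1 i⟩
      simpa using (abs_apply_le ι (φ ω - ψ) (hF i)).trans h1
    rw [this]
    exact MeasurableSet.iInter fun i => measurableSet_le ((h (F i)).sub_const _).abs measurable_const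
  refine measurable_of_isOpen fun U hU => ?_
  have : U = ⋃ (i : ℕ × ℕ) (_ : Metric.closedBall (denseSeq E i.1) (1 / (i.2 + 1)) ⊆ U),
      Metric.closedBall (denseSeq E i.1) (1 / ((i.2 : ℝ) + 1)) := by
    refine Subset.antisymm (fun ψ hψ => ?_) (iUnion₂_subset fun _ h => h)
    obtain ⟨ε, hε, hεU⟩ := Metric.isOpen_iff.1 hU ψ hψ
    obtain ⟨n, hn⟩ := exists_nat_one_div_lt (K := ℝ) (ε := ε / 2) (by positivity)
    obtain ⟨k, hk⟩ := (denseRange_denseSeq E).exists_dist_lt ψ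
      (ε := 1 / ((n : ℝ) + 1)) (by positivity)
    refine mem_iUnion₂.2 ⟨(k, n), fun χ hχ => hεU ?_, hk.le⟩
    rw [Metric.mem_closedBall] at hχ
    rw [dist_comm] at hk
    exact (dist_triangle _ _ _).trans_lt (by simp only at hχ; linarith)
  rw [this]
  simp only [preimage_iUnion]
  exact MeasurableSet.iUnion fun i => MeasurableSet.iUnion fun _ => hball _ _

theorem aestronglyMeasurable_of_forall_apply [SeparableSpace E]
    {Ω : Type*} [MeasurableSpace Ω] {P : Measure Ω} {φ : Ω → E}
    (h : ∀ f : V, AEMeasurable (fun ω => ι (φ ω) f) P) : AEStronglyMeasurable φ P := by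
  let _ : MeasurableSpace E := borel E
  have : BorelSpace E := ⟨rfl⟩
  have : SecondCountableTopology E := UniformSpace.secondCountable_of_separable _
  -- Over the completed σ-algebra, almost everywhere measurable scalar functions are measurable, so
  -- the previous theorem applies.
  have hn : NullMeasurable φ P :=
    measurable_of_forall_apply ι (Ω := NullMeasurableSpace Ω P) fun f => (h f).nullMeasurable
  exact hn.aemeasurable.aestronglyMeasurable

/-- Integrating a weakly measurable family of functionals gives a functional. -/
theorem exists_forall_apply_eq_integral [SeparableSpace E] [CompleteSpace E]
    {Ω : Type*} [MeasurableSpace Ω] {P : Measure Ω} {φ : Ω → E}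
    (h : ∀ f : V, AEMeasurable (fun ω => ι (φ ω) f) P) {b : Ω → ℝ}
    (hb : Integrable b P) (hφ : ∀ᵐ ω ∂P, ‖φ ω‖ ≤ b ω) :
    ∃ Φ : E, ∀ f : V, ι Φ f = ∫ ω, ι (φ ω) f ∂P := by
  have hi : Integrable φ P := hb.mono' (aestronglyMeasurable_of_forall_apply ι h) hφ
  refine ⟨∫ ω, φ ω ∂P, fun f => ?_⟩
  exact (((ContinuousLinearMap.apply ℝ ℝ f).comp
    ι.toContinuousLinearMap).integral_comp_comm hi).symm

end WeaklyMeasurable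

namespace LipB

variable {X : Type*} [MetricSpace X]

theorem lipschitzWith_pointEval : LipschitzWith 1 (pointEval (X := X)) :=
  LipschitzWith.of_dist_le_mul fun x y => by
    rw [dist_eq_norm, NNReal.coe_one, one_mul]
    refine ContinuousLinearMap.opNorm_le_bound _ dist_nonneg fun f => ?_
    have h := f.lipschitzWith.dist_le_mul x y
    rwa [dist_eq_norm, coe_nnnorm, mul_comm] at h

theorem isClosed_predual : IsClosed (predual X : Set (StrongDual ℝ (LipB X))) :=
  Submodule.isClosed_topologicalClosure _

theorem isSeparable_predual [SeparableSpace X] :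
    IsSeparable (predual X : Set (StrongDual ℝ (LipB X))) := by
  rw [predual, Submodule.topologicalClosure_coe]
  exact (isSeparable_range lipschitzWith_pointEval.continuous).span.closure

theorem exists_mem_predual_integral [SeparableSpace X] {Ω : Type*} [MeasurableSpace Ω]
    {P : Measure Ω} {φ : Ω → StrongDual ℝ (LipB X)} (hφp : ∀ ω, φ ω ∈ predual X)
    (h : ∀ f : LipB X, AEMeasurable (fun ω => φ ω f) P) {b : Ω → ℝ}
    (hb : Integrable b P) (hφ : ∀ᵐ ω ∂P, ‖φ ω‖ ≤ b ω) :
    ∃ Φ ∈ predual X, ∀ f : LipB X, Φ f = ∫ ω, φ ω f ∂P := by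
  have : SeparableSpace (predual X) := isSeparable_predual.separableSpace
  have : CompleteSpace (predual X) := isClosed_predual.completeSpace_coe
  let φ' : Ω → predual X := fun ω => ⟨φ ω, hφp ω⟩
  have hφ' : ∀ᵐ ω ∂P, ‖φ' ω‖ ≤ b ω := hφ
  obtain ⟨Φ, hΦ⟩ := exists_forall_apply_eq_integral (predual X).subtypeₗᵢ h hb hφ'
  exact ⟨Φ.1, Φ.2, hΦ⟩

theorem continuous_weakStar {Φ : StrongDual ℝ (LipB X)} (hΦ : Φ ∈ predual X) :
    @Continuous (LipB X) ℝ (weakStar X) inferInstance Φ :=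
  continuous_iInf_dom (continuous_iInf_dom (i := hΦ) continuous_induced_dom)

end LipB

open ProbabilityTheory

/-! ### The derivation of an Alberti representation -/

/-- There is no uniform bound on the masses, so the kernel is cut according to the integer part `n`
of its total mass; each piece is bounded by `n + 1`. -/
theorem isSFiniteKernel_of_isFiniteMeasure {α β : Type*} [MeasurableSpace α] [MeasurableSpace β]
    (κ : Kernel α β) (h : ∀ a, IsFiniteMeasure (κ a)) : IsSFiniteKernel κ := by
  classical
  have hm : Measurable fun a => ⌊(κ a univ).toNNReal⌋₊ :=
    (κ.measurable_coe MeasurableSet.univ).ennreal_toNNReal.nat_floor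
  have hS : ∀ n, MeasurableSet {a | ⌊(κ a univ).toNNReal⌋₊ = n} := fun n =>
    hm (measurableSet_singleton n)
  refine ⟨fun n => Kernel.piecewise (hS n) κ 0, fun n => ⟨⟨(n + 1 : ℕ), by simp, fun a => ?_⟩⟩, ?_⟩
  · rw [Kernel.piecewise_apply]
    split_ifs with ha
    · have h1 := Nat.lt_floor_add_one (κ a univ).toNNReal
      rw [← ENNReal.coe_toNNReal (measure_ne_top (κ a) univ)]
      rw [mem_ofPred_eq] at ha
      rw [ha] at h1
      exact_mod_cast h1.le
    · simp
  · ext a s hs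
    rw [Kernel.sum_apply' _ _ hs, tsum_eq_single ⌊(κ a univ).toNNReal⌋₊]
    · rw [Kernel.piecewise_apply, if_pos (by simp)]
    · intro n hn
      rw [Kernel.piecewise_apply, if_neg (by simpa using hn.symm)]
      simp

namespace IsAlbertiRep

variable {X : Type*} [MetricSpace X] [MeasurableSpace X] [BorelSpace X]
  {A : FragPair X} {μ : Measure X} (hA : IsAlbertiRep A μ)

/-- The measures `ν γ` as a kernel from fragments to points. -/
def kernel : Kernel (Frag X) X := ⟨A.ν, hA.measurable⟩

instance : IsSFiniteKernel hA.kernel :=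
  isSFiniteKernel_of_isFiniteMeasure _ hA.isFiniteMeasure

/-- The measure on `Frag X × X` with first marginal `P` and conditional measures `ν γ`. -/
noncomputable def total : Measure (Frag X × X) := A.P ⊗ₘ hA.kernel

theorem snd_total : hA.total.snd = μ := by
  have := hA.isProbabilityMeasure
  ext s hs
  rw [total, Measure.snd_compProd, Measure.bind_apply hs hA.kernel.measurable.aemeasurable,
    hA.repr s hs]
  rfl

theorem ae_total {p : Frag X × X → Prop} (hp : MeasurableSet {q | p q})
    (h : ∀ᵐ γ ∂A.P, ∀ᵐ x ∂A.ν γ, p (γ, x)) : ∀ᵐ q ∂hA.total, p q := by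
  have := hA.isProbabilityMeasure
  exact Measure.ae_compProd_of_ae_ae hp h

variable {g : X → ℝ}

theorem integrable_comp_snd (hg : Integrable g μ) :
    Integrable (fun q : Frag X × X => g q.2) hA.total := by
  rw [← hA.snd_total, Measure.snd] at hg
  exact hg.comp_measurable measurable_snd

theorem ae_integrable (hA : IsAlbertiRep A μ) (hg : Integrable g μ) : ∀ᵐ γ ∂A.P, Integrable g (A.ν γ) := by
  have := hA.isProbabilityMeasure
  have h := hA.integrable_comp_snd hg
  exact ((Measure.integrable_compProd_iff h.aestronglyMeasurable).1 h).1

theorem integrable_integral_abs (hA : IsAlbertiRep A μ) (hg : Integrable g μ) :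
    Integrable (fun γ => ∫ x, |g x| ∂A.ν γ) A.P := by
  have := hA.isProbabilityMeasure
  have h := hA.integrable_comp_snd hg
  exact ((Measure.integrable_compProd_iff h.aestronglyMeasurable).1 h).2

theorem integral_upperSlope_eq (hA : IsAlbertiRep A μ) (f : LipB X) (γ : Frag X) :
    ∫ x, g x * Frag.upperSlope f (γ, x) ∂A.ν γ = ∫ x, g x * γ.partialDeriv f x ∂A.ν γ := by
  refine integral_congr_ae ?_
  filter_upwards [γ.upperSlope_ae_eq (hA.absolutelyContinuous γ) f.lipschitzWith] with x hx
  rw [hx]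

theorem integral_pullMeasure_eq (hA : IsAlbertiRep A μ) (f g : X → ℝ) (γ : Frag X) :
    ∫ t : γ.dom, γ.derivOn (fun s => f (γ s)) t * g (γ t) ∂(γ.pullMeasure (A.ν γ))
      = ∫ x, g x * γ.partialDeriv f x ∂(A.ν γ) := by
  conv_rhs => rw [← γ.pullMeasure_map (hA.absolutelyContinuous γ),
    γ.measurableEmbedding.integral_map]
  simp only [Frag.partialDeriv_apply, mul_comm]

variable [SecondCountableTopology X] {C : ℝ≥0}

theorem measurable_upperSlope (f : LipB X) : Measurable (Frag.upperSlope (f : X → ℝ)) :=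
  Frag.measurable_upperSlope f.toBCF.continuous

theorem ae_abs_upperSlope_le (hC : A.IsCLipschitz C) (f : LipB X) :
    ∀ᵐ q ∂hA.total, |Frag.upperSlope f q| ≤ C * ‖f‖ := by
  refine hA.ae_total (measurableSet_le (measurable_upperSlope f).abs measurable_const) ?_
  filter_upwards [hC] with γ hγ
  filter_upwards [γ.upperSlope_ae_eq (hA.absolutelyContinuous γ) f.lipschitzWith] with x hx
  rw [hx, mul_comm]
  exact Frag.abs_partialDeriv_le hγ f.lipschitzWith x

theorem integrable_mul_upperSlope (hC : A.IsCLipschitz C) (hg : Integrable g μ) (f : LipB X) :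
    Integrable (fun q : Frag X × X => g q.2 * Frag.upperSlope f q) hA.total := by
  simpa [mul_comm] using (hA.integrable_comp_snd hg).bdd_mul
    (measurable_upperSlope f).aestronglyMeasurable (hA.ae_abs_upperSlope_le hC f)

theorem integrable_integral_partialDeriv (hA : IsAlbertiRep A μ) (hC : A.IsCLipschitz C)
    (hg : Integrable g μ) (f : LipB X) : Integrable (fun γ : Frag X => ∫ x, g x * γ.partialDeriv f x ∂A.ν γ) A.P := by
  have := hA.isProbabilityMeasure
  have h := Integrable.integral_compProd (hA.integrable_mul_upperSlope hC hg f)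
  exact h.congr (Eventually.of_forall fun γ => hA.integral_upperSlope_eq f γ)

theorem integral_total_eq (hC : A.IsCLipschitz C) (hg : Integrable g μ) (f : LipB X) :
    ∫ q, g q.2 * Frag.upperSlope f q ∂hA.total
      = ∫ γ : Frag X, (∫ x, g x * γ.partialDeriv f x ∂A.ν γ) ∂A.P := by
  have := hA.isProbabilityMeasure
  rw [total, Measure.integral_compProd (hA.integrable_mul_upperSlope hC hg f)]
  exact integral_congr_ae (Eventually.of_forall fun γ => hA.integral_upperSlope_eq f γ)

/-- This gives weak* continuity. By Fubini the functional is the `P`-average of the fragmentwise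
ones, which lie in the predual with norms at most `C ∫ |g| dν_γ`, a `P`-integrable bound. -/
theorem exists_mem_predual [SeparableSpace X] (hC : A.IsCLipschitz C) (hg : Integrable g μ) :
    ∃ Φ ∈ LipB.predual X, ∀ f : LipB X,
      Φ f = ∫ q, g q.2 * Frag.upperSlope f q ∂hA.total := by
  classical
  -- On the `P`-null set of fragments that are not `C`-Lipschitz or along which `g` is not
  -- integrable, the functional is taken to be `0`.
  have h1 : ∀ γ : Frag X, ∃ φ ∈ LipB.predual X,
      LipschitzWith C γ.toFun ∧ Integrable g (A.ν γ) → ‖φ‖ ≤ C * ∫ x, |g x| ∂A.ν γ ∧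
        ∀ f : LipB X, φ f = ∫ x, g x * γ.partialDeriv f x ∂A.ν γ := by
    intro γ
    by_cases h : LipschitzWith C γ.toFun ∧ Integrable g (A.ν γ)
    · have := hA.isFiniteMeasure γ
      obtain ⟨φ, hφ, h1⟩ := γ.exists_mem_predual (hA.absolutelyContinuous γ) h.1 h.2
      exact ⟨φ, hφ, fun _ => h1⟩
    · exact ⟨0, zero_mem _, fun h' => absurd h' h⟩
  choose φ hφ hφ' using h1
  have hgood : ∀ᵐ γ ∂A.P, LipschitzWith C (Frag.toFun γ) ∧ Integrable g (A.ν γ) :=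
    Eventually.and hC (hA.ae_integrable hg)
  obtain ⟨Φ, hΦ, hΦ'⟩ := LipB.exists_mem_predual_integral hφ (fun f =>
    (hA.integrable_integral_partialDeriv hC hg f).aestronglyMeasurable.aemeasurable.congr
      (hgood.mono fun γ hγ => ((hφ' γ hγ).2 f).symm))
    ((hA.integrable_integral_abs hg).const_mul C) (hgood.mono fun γ hγ => (hφ' γ hγ).1)
  refine ⟨Φ, hΦ, fun f => ?_⟩
  rw [hΦ', hA.integral_total_eq hC hg]
  exact integral_congr_ae (hgood.mono fun γ hγ => (hφ' γ hγ).2 f)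

theorem upperSlope_add_ae (f g : LipB X) : (Frag.upperSlope (f + g : LipB X)) =ᵐ[hA.total]
    fun q => Frag.upperSlope f q + Frag.upperSlope g q := by
  refine hA.ae_total (measurableSet_eq_fun (measurable_upperSlope _)
    ((measurable_upperSlope f).add (measurable_upperSlope g))) (Eventually.of_forall fun γ => ?_)
  have hν := hA.absolutelyContinuous γ
  filter_upwards [γ.upperSlope_ae_eq hν f.lipschitzWith, γ.upperSlope_ae_eq hν g.lipschitzWith,
    γ.upperSlope_ae_eq hν (f + g).lipschitzWith, γ.partialDeriv_add_ae hν f g] with x h1 h2 h3 h4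
  rw [h1, h2, h3, h4]

theorem upperSlope_smul_ae (c : ℝ) (f : LipB X) : (Frag.upperSlope (c • f : LipB X)) =ᵐ[hA.total]
    fun q => c * Frag.upperSlope f q := by
  refine hA.ae_total (measurableSet_eq_fun (measurable_upperSlope _)
    ((measurable_upperSlope f).const_mul c)) (Eventually.of_forall fun γ => ?_)
  have hν := hA.absolutelyContinuous γ
  filter_upwards [γ.upperSlope_ae_eq hν f.lipschitzWith,
    γ.upperSlope_ae_eq hν (c • f).lipschitzWith] with x h1 h2
  rw [h1, h2, γ.partialDeriv_smul]

theorem upperSlope_mul_ae (f g : LipB X) : (Frag.upperSlope (f * g : LipB X)) =ᵐ[hA.total]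
    fun q => f q.2 * Frag.upperSlope g q + g q.2 * Frag.upperSlope f q := by
  have hm : ∀ f : LipB X, Measurable fun q : Frag X × X => f q.2 := fun f =>
    f.toBCF.continuous.measurable.comp measurable_snd
  refine hA.ae_total (measurableSet_eq_fun (measurable_upperSlope _)
    (((hm f).mul (measurable_upperSlope g)).add ((hm g).mul (measurable_upperSlope f))))
    (Eventually.of_forall fun γ => ?_)
  have hν := hA.absolutelyContinuous γ
  filter_upwards [γ.upperSlope_ae_eq hν f.lipschitzWith, γ.upperSlope_ae_eq hν g.lipschitzWith,
    γ.upperSlope_ae_eq hν (f * g).lipschitzWith, γ.partialDeriv_mul_ae hν f g] with x h1 h2 h3 h4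
  rw [h1, h2, h3, h4]

theorem exists_derivation [SeparableSpace X] [SigmaFinite μ] (hC : A.IsCLipschitz C) :
    ∃ D : Derivations μ, ‖D‖ ≤ C ∧ ∀ (f : LipB X) (g : X → ℝ), Integrable g μ →
      ∫ x, g x * D.1 f x ∂μ = ∫ q, g q.2 * Frag.upperSlope f q ∂hA.total := by
  choose u hu hu' using fun f : LipB X => exists_memLp_top_integral_eq hA.snd_total
    (measurable_upperSlope f) (by positivity) (hA.ae_abs_upperSlope_le hC f)
  have hadd : ∀ f g, u (f + g) = u f + u g := by
    intro f g
    refine Lp_top_ext_of_integral_eq fun h _ _ hh => ?_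
    calc ∫ x, h x * u (f + g) x ∂μ
        = ∫ q, (h q.2 * Frag.upperSlope f q + h q.2 * Frag.upperSlope g q) ∂hA.total := by
          rw [hu' _ _ hh]
          refine integral_congr_ae ?_
          filter_upwards [hA.upperSlope_add_ae f g] with q hq
          rw [hq, mul_add]
      _ = ∫ x, (h x * u f x + h x * u g x) ∂μ := by
          rw [integral_add (hA.integrable_mul_upperSlope hC hh f)
            (hA.integrable_mul_upperSlope hC hh g), ← hu' _ _ hh, ← hu' _ _ hh,
            integral_add (integrable_mul_linfty hh _) (integrable_mul_linfty hh _)]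
      _ = ∫ x, h x * (u f + u g : Lp ℝ ∞ μ) x ∂μ := by
          refine integral_congr_ae ?_
          filter_upwards [Lp.coeFn_add (u f) (u g)] with x hx
          rw [hx, Pi.add_apply, mul_add]
  have hsmul : ∀ (c : ℝ) f, u (c • f) = c • u f := by
    intro c f
    refine Lp_top_ext_of_integral_eq fun h _ _ hh => ?_
    calc ∫ x, h x * u (c • f) x ∂μ = ∫ q, c * (h q.2 * Frag.upperSlope f q) ∂hA.total := by
          rw [hu' _ _ hh]
          refine integral_congr_ae ?_
          filter_upwards [hA.upperSlope_smul_ae c f] with q hq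
          rw [hq, mul_left_comm]
      _ = ∫ x, c * (h x * u f x) ∂μ := by
          rw [integral_const_mul, integral_const_mul, hu' _ _ hh]
      _ = ∫ x, h x * (c • u f : Lp ℝ ∞ μ) x ∂μ := by
          refine integral_congr_ae ?_
          filter_upwards [Lp.coeFn_smul c (u f)] with x hx
          rw [hx, Pi.smul_apply, smul_eq_mul, mul_left_comm]
  let D : LipB X →L[ℝ] Lp ℝ ∞ μ :=
    LinearMap.mkContinuous { toFun := u, map_add' := hadd, map_smul' := hsmul } C hu
  have hD : ∀ f, D f = u f := fun f => rfl
  have hweak : IsWeakStarContinuous μ D := by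
    refine isWeakStarContinuous_iff.2 fun h hh => ?_
    obtain ⟨Φ, hΦ, hΦ'⟩ := hA.exists_mem_predual hC hh
    convert LipB.continuous_weakStar hΦ using 1
    ext f
    rw [hD, hu' f h hh, hΦ']
  have hbdd : ∀ (f : LipB X) (h : X → ℝ), Integrable h μ → Integrable (fun x => h x * f x) μ := by
    intro f h hh
    simpa [mul_comm] using hh.bdd_mul f.toBCF.continuous.measurable.aestronglyMeasurable
      (Eventually.of_forall f.toBCF.norm_coe_le_norm)
  have hprod : SatisfiesProductRule μ D := by
    intro f g
    have hmem : MemLp (fun x => f x * D g x + g x * D f x) ∞ μ := by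
      have hm : ∀ f : LipB X, MemLp (f : X → ℝ) ∞ μ := fun f =>
        memLp_top_of_bound f.toBCF.continuous.measurable.aestronglyMeasurable ‖f.toBCF‖
          (Eventually.of_forall f.toBCF.norm_coe_le_norm)
      exact ((Lp.memLp (D g)).mul (hm f)).add ((Lp.memLp (D f)).mul (hm g))
    -- Tested against `h`, the product rule along fragments uses the weights `h f` and `h g`, still
    -- integrable since `f` and `g` are bounded.
    have key : D (f * g) = hmem.toLp := by
      refine Lp_top_ext_of_integral_eq fun h _ _ hh => ?_
      calc ∫ x, h x * u (f * g) x ∂μ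
          = ∫ q, ((h q.2 * f q.2) * Frag.upperSlope g q + (h q.2 * g q.2) * Frag.upperSlope f q)
              ∂hA.total := by
            rw [hu' _ _ hh]
            refine integral_congr_ae ?_
            filter_upwards [hA.upperSlope_mul_ae f g] with q hq
            rw [hq]
            ring
        _ = ∫ x, ((h x * f x) * u g x + (h x * g x) * u f x) ∂μ := by
            rw [integral_add (hA.integrable_mul_upperSlope hC (hbdd f h hh) g)
              (hA.integrable_mul_upperSlope hC (hbdd g h hh) f), ← hu' _ _ (hbdd f h hh),
              ← hu' _ _ (hbdd g h hh), integral_add (integrable_mul_linfty (hbdd f h hh) _)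
                (integrable_mul_linfty (hbdd g h hh) _)]
        _ = ∫ x, h x * hmem.toLp _ x ∂μ := by
            refine integral_congr_ae ?_
            filter_upwards [hmem.coeFn_toLp] with x hx
            rw [hx, hD, hD]
            ring
    rw [key]
    exact hmem.coeFn_toLp
  exact ⟨⟨D, hweak, hprod⟩, LinearMap.mkContinuous_norm_le _ C.2 hu, fun f g hg => hu' f g hg⟩

theorem albertiFormula (hC : A.IsCLipschitz C) (hg : Integrable g μ) (f : LipB X) {u : Lp ℝ ∞ μ}
    (hu : ∫ x, g x * u x ∂μ = ∫ q, g q.2 * Frag.upperSlope f q ∂hA.total) :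
    AlbertiFormula A μ f u g := by
  have him : ∀ᵐ γ ∂A.P, Integrable (fun x => g x * γ.partialDeriv f x) (A.ν γ) := by
    filter_upwards [hA.ae_integrable hg] with γ hγ
    exact γ.integrable_mul_partialDeriv (hA.absolutelyContinuous γ) hγ f
  have hright := hA.integrable_integral_partialDeriv hC hg f
  have heq := hu.trans (hA.integral_total_eq hC hg f)
  refine ⟨integrable_mul_linfty hg u, ?_, ?_, him, hright, ?_, heq⟩
  · filter_upwards [him] with γ hγ
    rw [← γ.pullMeasure_map (hA.absolutelyContinuous γ),
      γ.measurableEmbedding.integrable_map_iff] at hγ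
    refine hγ.congr (Eventually.of_forall fun t => ?_)
    simp only [Function.comp_apply, Frag.partialDeriv_apply, mul_comm]
  · simpa only [hA.integral_pullMeasure_eq] using hright
  · simpa only [hA.integral_pullMeasure_eq] using heq

theorem exists_isAlbertiDerivation (hA : IsAlbertiRep A μ) [SeparableSpace X] [SigmaFinite μ]
    (hC : A.IsCLipschitz C) :
    ∃ D : Derivations μ, IsAlbertiDerivation A μ D ∧ ‖D‖ ≤ C := by
  obtain ⟨D, hDC, hD⟩ := hA.exists_derivation hC
  refine ⟨D, fun f u => ⟨fun h => ?_, ?_⟩, hDC⟩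
  · refine Lp_top_ext_of_integral_eq fun g hg hgb hgi => ?_
    rw [(h g hg hgb hgi).eq_right, hD f g hgi, hA.integral_total_eq hC hgi]
  · rintro rfl g - - hgi
    exact hA.albertiFormula hC hgi f (hD f g hgi)

end IsAlbertiRep

/-! ### Extension by zero -/

section ZeroExtension

section
variable {X : Type*} [MeasurableSpace X] {μ : Measure X} {S : Set X}

theorem memLp_indicator_linfty (hS : MeasurableSet S) (u : Lp ℝ ∞ (μ.restrict S)) :
    MemLp (S.indicator u) ∞ μ :=
  (memLp_indicator_iff_restrict hS).2 (Lp.memLp u)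

/-- Extension by zero, as a bounded linear map on `L^∞`. -/
noncomputable def linftyExtend (μ : Measure X) (hS : MeasurableSet S) :
    Lp ℝ ∞ (μ.restrict S) →L[ℝ] Lp ℝ ∞ μ :=
  LinearMap.mkContinuous
    { toFun := fun u => (memLp_indicator_linfty hS u).toLp
      map_add' := fun u v => by
        rw [← MemLp.toLp_add, MemLp.toLp_eq_toLp_iff]
        filter_upwards [(ae_restrict_iff' hS).1 (Lp.coeFn_add u v)] with x hx
        by_cases hxS : x ∈ S
        · simpa [hxS] using hx hxS
        · simp [hxS]
      map_smul' := fun c u => by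
        rw [RingHom.id_apply, ← MemLp.toLp_const_smul, MemLp.toLp_eq_toLp_iff]
        filter_upwards [(ae_restrict_iff' hS).1 (Lp.coeFn_smul c u)] with x hx
        by_cases hxS : x ∈ S
        · simpa [hxS] using hx hxS
        · simp [hxS] } 1 fun u => by
    rw [one_mul]
    change ‖(memLp_indicator_linfty hS u).toLp‖ ≤ ‖u‖
    rw [Lp.norm_toLp, eLpNorm_indicator_eq_eLpNorm_restrict hS, Lp.norm_def]

theorem linftyExtend_coeFn (hS : MeasurableSet S) (u : Lp ℝ ∞ (μ.restrict S)) :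
    linftyExtend μ hS u =ᵐ[μ] S.indicator u :=
  (memLp_indicator_linfty hS u).coeFn_toLp

theorem ae_eq_of_restrict_eq {S T : Set X} (hS : MeasurableSet S) (hT : MeasurableSet T)
    (h : μ.restrict S = μ.restrict T) : S =ᵐ[μ] T := by
  have key : ∀ {S T : Set X}, MeasurableSet S → MeasurableSet T →
      μ.restrict S = μ.restrict T → μ (S \ T) = 0 := by
    intro S T hS hT h
    have h1 : μ.restrict S Tᶜ = μ.restrict T Tᶜ := by rw [h]
    rwa [Measure.restrict_apply hT.compl, Measure.restrict_apply hT.compl, compl_inter_self,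
      measure_empty, inter_comm, ← sdiff_eq] at h1
  exact ae_eq_set.2 ⟨key hS hT h, key hT hS h.symm⟩

end

variable {X : Type*} [MetricSpace X] [MeasurableSpace X] {μ : Measure X} {S : Set X}

/-- Pairing `h` with the extension equals pairing `h` with `D f` over `S`, so weak* continuity is
inherited; the product rule is that of `D` on `S` and trivial off `S`. -/
theorem exists_isZeroExtension (hS : MeasurableSet S) (D : Derivations (μ.restrict S)) :
    ∃ D' : Derivations μ, IsZeroExtension S D D' := by
  have hE : ∀ f, (linftyExtend μ hS).comp D.1 f =ᵐ[μ] S.indicator (D.1 f) := fun f =>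
    linftyExtend_coeFn hS (D.1 f)
  refine ⟨⟨(linftyExtend μ hS).comp D.1, ?_, fun f g => ?_⟩, fun f => ⟨?_, ?_⟩⟩
  · refine isWeakStarContinuous_iff.2 fun h hh => ?_
    convert isWeakStarContinuous_iff.1 D.2.1 h hh.restrict using 1
    ext f
    rw [← integral_indicator hS]
    refine integral_congr_ae ?_
    filter_upwards [hE f] with x hx
    rw [hx]
    by_cases hxS : x ∈ S <;> simp [hxS]
  · have h1 := (ae_restrict_iff' hS).1 (D.2.2 f g)
    filter_upwards [h1, hE (f * g), hE f, hE g] with x h1 h2 h3 h4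
    rw [h2, h3, h4]
    by_cases hxS : x ∈ S
    · simpa [hxS] using h1 hxS
    · simp [hxS]
  · filter_upwards [ae_restrict_of_ae (hE f), ae_restrict_mem hS] with x hx hxS
    exact hx.trans (indicator_of_mem hxS _)
  · filter_upwards [ae_restrict_of_ae (hE f), ae_restrict_mem hS.compl] with x hx hxS
    exact hx.trans (indicator_of_notMem hxS _)

theorem IsZeroExtension.unique {D : Derivations (μ.restrict S)}
    {D₁ D₂ : Derivations μ} (h₁ : IsZeroExtension S D D₁) (h₂ : IsZeroExtension S D D₂) :
    D₁ = D₂ := by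
  refine Subtype.ext (ContinuousLinearMap.ext fun f => Lp.ext ?_)
  refine ae_of_ae_restrict_of_ae_restrict_compl S ?_ ?_
  · filter_upwards [(h₁ f).1, (h₂ f).1] with x hx hx'
    rw [hx, hx']
  · filter_upwards [(h₁ f).2, (h₂ f).2] with x hx hx'
    rw [hx, hx']

theorem IsAlbertiDerivation.unique {A : FragPair X} {D₁ D₂ : Derivations μ}
    (h₁ : IsAlbertiDerivation A μ D₁) (h₂ : IsAlbertiDerivation A μ D₂) : D₁ = D₂ :=
  Subtype.ext (ContinuousLinearMap.ext fun f => (h₂ f _).1 ((h₁ f _).2 rfl))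

theorem IsAlbertiDerivation.congr_measure {A : FragPair X} {m m' : Measure X} (h : m = m')
    {D : Derivations m} (hD : IsAlbertiDerivation A m D) :
    ∃ D' : Derivations m', IsAlbertiDerivation A m' D' ∧ ∀ f, D.1 f =ᵐ[m] D'.1 f := by
  subst h
  exact ⟨D, hD, fun f => EventuallyEq.rfl⟩

/-- The zero extension of the derivation of an Alberti representation of a restriction of `μ` does
not depend on the set to which `μ` is restricted. -/
theorem IsZeroExtension.congr_set {A : FragPair X} {T : Set X} (hS : MeasurableSet S)
    (hT : MeasurableSet T) (h : μ.restrict S = μ.restrict T) {D : Derivations (μ.restrict S)}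
    (hD : IsAlbertiDerivation A (μ.restrict S) D) {E : Derivations μ} (hE : IsZeroExtension S D E) :
    ∃ D' : Derivations (μ.restrict T),
      IsAlbertiDerivation A (μ.restrict T) D' ∧ IsZeroExtension T D' E := by
  obtain ⟨D', hD', hDD'⟩ := hD.congr_measure h
  have hc : μ.restrict Sᶜ = μ.restrict Tᶜ :=
    Measure.restrict_congr_set (ae_eq_of_restrict_eq hS hT h).compl
  have h1 : ∀ f, E.1 f =ᵐ[μ.restrict S] D'.1 f := fun f => (hE f).1.trans (hDD' f)
  exact ⟨D', hD', fun f => ⟨(h1 f).filter_mono (by rw [h]), (hE f).2.filter_mono (by rw [hc])⟩⟩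

end ZeroExtension

theorem mainTheorem7 {X : Type*} [MetricSpace X] [SeparableSpace X] [MeasurableSpace X]
    [BorelSpace X] (μ : Measure X) [IsLocallyFiniteMeasure μ] :
    (∀ (A : FragPair X) (C : ℝ≥0), IsAlbertiRep A μ → A.IsCLipschitz C →
      ∃ D : Derivations μ, IsAlbertiDerivation A μ D ∧ ‖D‖ ≤ C) ∧
    (∃! Der : AlbSub μ → Derivations μ, ∀ (A : AlbSub μ) (S : Set X), MeasurableSet S →
      A.1 ∈ Alb (μ.restrict S) →
      ∃ D : Derivations (μ.restrict S),
        IsAlbertiDerivation A.1 (μ.restrict S) D ∧ IsZeroExtension S D (Der A)) := by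
  -- With local finiteness this makes `μ` and its restrictions σ-finite, as the Radon-Nikodym
  -- argument requires.
  have : SecondCountableTopology X := UniformSpace.secondCountable_of_separable X
  refine ⟨fun A C hA hC => hA.exists_isAlbertiDerivation hC, ?_⟩
  have hex : ∀ A : AlbSub μ, ∃ E : Derivations μ, ∃ S, MeasurableSet S ∧
      A.1 ∈ Alb (μ.restrict S) ∧ ∃ D : Derivations (μ.restrict S),
        IsAlbertiDerivation A.1 (μ.restrict S) D ∧ IsZeroExtension S D E := by
    rintro ⟨A, S, hS, hA, C, hC⟩
    obtain ⟨D, hD, -⟩ := hA.exists_isAlbertiDerivation hC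
    obtain ⟨E, hE⟩ := exists_isZeroExtension hS D
    exact ⟨E, S, hS, ⟨hA, C, hC⟩, D, hD, hE⟩
  choose Der S hS hAS D hD hDer using hex
  refine ⟨Der, fun A T hT hAT => ?_, fun Der' h' => funext fun A => ?_⟩
  · have h : μ.restrict (S A) = μ.restrict T := by
      ext E hE
      rw [(hAS A).1.repr E hE, hAT.1.repr E hE]
    exact (hDer A).congr_set (hS A) hT h (hD A)
  · obtain ⟨D', hD', hE'⟩ := h' A (S A) (hS A) (hAS A)
    rw [hD'.unique (hD A)] at hE'
    exact hE'.unique (hDer A)
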